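/- Let $f:2^E\to\mathbb{R}_{\ge 0}$ be submodular ($f(A\cup B)+f(A\cap B)\le f(A)+f(B)$), monotone, with $f(\emptyset)=0$, where $E$ is a finite set whose elements arrive one by one, each exactly once and in arbitrary order, in a stream. Let $\operatorname{curv}(f)\in[0,1]$ be the least $c$ in $[0,1]$ with $f(A\cup\{e\})-f(A)\ge(1-c)f(\{e\})$ for all $A\subseteq E$ and $e\in E\setminus A$. For a family $\mathcal I$ of subsets of $E$, call $I\in\mathcal I$ $\alpha$-approximate if $f(I)\ge\alpha^{-1}f(I')$ for all $I'\in\mathcal I$. The algorithms below are deterministic, read the stream once, know neither $f$ nor $\operatorname{curv}(f)$ in advance, and have access to $f$ only through a value oracle, which may be asked for $f(S)$ only if all elements of $S$ are currently stored. A stored value of $f$ counts as one unit of storage, $x/0$ is read as $+\infty$, and the constants implied by $O(\cdot)$ are absolute in (1) and depend only on $p$ in (2) and (3). (1) (Matchings.) For every $n$ there is a one-pass algorithm that, for every stream of the edges $E$ of a simple graph on the vertex set $\{1,\dots,n\}$ and every such $f$, outputs a $\min\{7.75,\ 5.585/(1-\operatorname{curv}(f))\}$-approximate matching, storing at all times $O(n)$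 edges, $O(n)$ values of $f$ and $O(n\log n)$ further bits. (2) (Hypermatchings.) For every $p\ge1$ and every $n$ there is a one-pass algorithm that, for every stream of distinct hyperedges $E$, each a set of at most $p$ of the $n$ vertices, and every such $f$, outputs a $\min\{4p,\ (2(p+\sqrt{p(p-1)})-1)/(1-\operatorname{curv}(f))\}$-approximate set of pairwise disjoint hyperedges, storing at all times $O(n)$ hyperedges, $O(n)$ values of $f$ and $O(n\log n)$ further bits. (3) (Intersection of $p$ matroids.) For every $p\ge1$ and every $N$ there is a one-pass algorithm that, for every stream of the elements of a set $E\subseteq\{1,\dots,N\}$, all matroids $M_1,\dots,M_p$ on $E$, accessed only through independence oracles applied to sets of currently stored elements, and every such $f$, outputs a $\min\{4p,\ (2(p+\sqrt{p(p-1)})-1)/(1-\operatorname{curv}(f))\}$-approximate common independent set, storing at all times $O(n)$ elements, $O(n)$ values of $f$ and $O(n\log N)$ further bits, where $n$ is the maximum size of a common independent set. In all three cases the algorithm makes $O(m+1)$ calls to the value oracle in total, where $m$ is the length of the stream. Storage bounds are read with $n+1$ in place of $n$ in (2) and (3), and with $\log$ replaced by $1+\lfloor\log_2\cdot\rfloor$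 throughout (so that they make sense for very small $n$ and $N$). -/

import Mathlib

/-! ### Submodular functions and curvature -/

/-- `f` is a non-negative, monotone, proper (`f ∅ = 0`) submodular function on the subsets
of the finite ground set `E`. Nothing is assumed about sets that are not contained in `E`. -/
structure IsMonoSubmodular {X : Type} [DecidableEq X] (E : Finset X) (f : Finset X → ℝ) :
    Prop where
  nonneg : ∀ A, A ⊆ E → 0 ≤ f A
  proper : f ∅ = 0
  mono : ∀ A B, A ⊆ B → B ⊆ E → f A ≤ f B
  submod : ∀ A B, A ⊆ E → B ⊆ E → f (A ∪ B) + f (A ∩ B) ≤ f A + f B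

/-- The defining inequality of curvature:
`f (A ∪ {e}) - f A ≥ (1 - c) f {e}` for all `A ⊆ E` and `e ∈ E \ A`. -/
def CurvatureBound {X : Type} [DecidableEq X] (E : Finset X) (f : Finset X → ℝ) (c : ℝ) :
    Prop :=
  ∀ A, A ⊆ E → ∀ e ∈ E \ A, (1 - c) * f {e} ≤ f (A ∪ {e}) - f A

/-- The curvature of `f : 2^E → ℝ`: the least admissible `c`. The restriction to `[0, 1]` only
matters if `f {e} = 0` for all `e ∈ E`, when every real `c` is admissible (the curvature is
then `0`); see `curvature_isLeast`. -/
noncomputable def curvature {X : Type} [DecidableEq X] (E : Finset X) (f : Finset X → ℝ) : ℝ :=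
  sInf {c : ℝ | 0 ≤ c ∧ c ≤ 1 ∧ CurvatureBound E f c}

/-- As soon as some singleton has positive value, `curvature E f` is the minimum of all real
numbers `c` that satisfy the defining inequality. -/
theorem curvature_isLeast {X : Type} [DecidableEq X] {E : Finset X} {f : Finset X → ℝ}
    (hf : IsMonoSubmodular E f) {x : X} (hx : x ∈ E) (hpos : 0 < f {x}) :
    IsLeast {c : ℝ | CurvatureBound E f c} (curvature E f) := by
  have hone : CurvatureBound E f 1 := by
    intro A hA e he
    have h := hf.mono A (A ∪ {e}) Finset.subset_union_left
      (Finset.union_subset hA (by simpa using (Finset.mem_sdiff.1 he).1))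
    linarith
  have hnon : ∀ c, CurvatureBound E f c → 0 ≤ c := by
    intro c hc
    have h := hc ∅ (Finset.empty_subset _) x (by simpa using hx)
    have h0 := hf.proper
    simp only [Finset.empty_union] at h
    nlinarith
  have hbdd : BddBelow {c : ℝ | 0 ≤ c ∧ c ≤ 1 ∧ CurvatureBound E f c} := ⟨0, fun c hc => hc.1⟩
  have hclosed : IsClosed {c : ℝ | 0 ≤ c ∧ c ≤ 1 ∧ CurvatureBound E f c} := by
    have : {c : ℝ | 0 ≤ c ∧ c ≤ 1 ∧ CurvatureBound E f c} = Set.Icc 0 1 ∩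
        ⋂ (A : Finset X) (_ : A ⊆ E) (e : X) (_ : e ∈ E \ A),
          {c : ℝ | (1 - c) * f {e} ≤ f (A ∪ {e}) - f A} := by
      ext c
      simp only [CurvatureBound, Set.mem_ofPred_eq, Set.mem_inter_iff, Set.mem_Icc,
        Set.mem_iInter, and_assoc]
    rw [this]
    refine isClosed_Icc.inter (isClosed_iInter fun A => isClosed_iInter fun _ =>
      isClosed_iInter fun e => isClosed_iInter fun _ => isClosed_le (by fun_prop) (by fun_prop))
  have hmem := hclosed.csInf_mem ⟨1, zero_le_one, le_rfl, hone⟩ hbdd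
  refine ⟨hmem.2.2, fun c hc => ?_⟩
  by_cases h1 : c ≤ 1
  · exact csInf_le hbdd ⟨hnon c hc, h1, hc⟩
  · exact le_trans hmem.2.1 (le_of_lt (not_le.1 h1))

/-- The approximation ratio `min {a, b / (1 - c)}`, where `b / (1 - c)` is read as `+∞`
if `c = 1`. -/
noncomputable def curvatureRatio (a b c : ℝ) : ℝ :=
  if c < 1 then min a (b / (1 - c)) else a

/-- `I` is an `a`-approximate maximizer of `f` over the independent subsets of `E`: it is one
of them, and `f I ≥ a⁻¹ f I'` for each of them. -/
def IsApproxMax {X : Type} (E : Finset X) (Ind : Finset X → Prop) (f : Finset X → ℝ) (a : ℝ)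
    (I : Finset X) : Prop :=
  I ⊆ E ∧ Ind I ∧ ∀ I', I' ⊆ E → Ind I' → a⁻¹ * f I' ≤ f I

/-- A set of edges (unordered pairs of vertices) is a matching if no two of its members share
a vertex. -/
def IsGraphMatching {V : Type} (M : Finset (Sym2 V)) : Prop :=
  ∀ e ∈ M, ∀ e' ∈ M, e ≠ e' → ∀ v, v ∈ e → v ∉ e'

/-- A set of hyperedges is a matching if its members are pairwise disjoint. -/
def IsHyperMatching {V : Type} (M : Finset (Finset V)) : Prop :=
  ∀ e ∈ M, ∀ e' ∈ M, e ≠ e' → Disjoint e e'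

/-! ### Streaming algorithms with oracles

A configuration of a machine consists of finitely many stored stream elements, a discrete
memory (whose size is measured in bits), and real registers. A real register can only be
overwritten by an answer of the value oracle, and the only access to its content is through the
sign of a linear combination of registers; so no other information can be hidden in it.
Elements that were forgotten cannot be recovered, and the oracles may only be asked about sets
of elements that are stored at that moment. -/

/-- The elementary actions of a machine on streams of elements of `X`, with discrete memory in
`Mem` and `p` independence oracles. The arguments of type `Mem` are the next memory content. -/
inductive StreamAction (X Mem : Type) (p : ℕ) : Type
  /-- Read and store the next stream element (`none` at the end of the stream). -/
  | read (next : Option X → Mem)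
  /-- Delete the elements of `T` from the store. -/
  | forget (T : Finset X) (next : Mem)
  /-- Write the oracle value `f S` into register `r`. -/
  | eval (S : Finset X) (r : ℕ) (next : Mem)
  /-- Branch on whether `∑ i, w i * (register i) ≥ 0`. -/
  | test (w : ℕ →₀ ℝ) (yes no : Mem)
  /-- Branch on whether `S` is independent for the `i`-th independence oracle. -/
  | indep (i : Fin p) (S : Finset X) (yes no : Mem)
  /-- Halt and output `S`. -/
  | output (S : Finset X)

/-- A deterministic streaming algorithm. Its next action is determined by its discrete memory
and the stored elements; `enc` writes the memory content as a bit string. -/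
structure StreamAlg (X : Type) (p : ℕ) where
  Mem : Type
  enc : Mem → List Bool
  enc_injective : Function.Injective enc
  start : Mem
  act : Mem → Finset X → StreamAction X Mem p

/-- The oracles: the value oracle for `f` and `p` independence oracles. -/
structure StreamOracles (X : Type) (p : ℕ) where
  value : Finset X → ℝ
  isIndep : Fin p → Finset X → Prop

/-- A configuration: discrete memory, stored elements, real registers, the number of registers
`0, 1, …, used - 1` occupied so far, the number of calls to the value oracle so far, and the
part of the stream that is still to be read. -/
structure StreamConfig (X Mem : Type) where
  mem : Mem
  store : Finset X
  reg : ℕ → ℝ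
  used : ℕ
  calls : ℕ
  input : List X

/-- The result of one step. -/
inductive StreamOutcome (X Mem : Type) : Type
  | run (c : StreamConfig X Mem)
  | halt (S : Finset X)
  | fail

namespace StreamAlg

variable {X : Type} [DecidableEq X] {p : ℕ}

open Classical in
/-- One step of the machine. It fails if it passes to an oracle, or outputs, a set that is not
contained in the store. -/
noncomputable def step (A : StreamAlg X p) (O : StreamOracles X p)
    (c : StreamConfig X A.Mem) : StreamOutcome X A.Mem :=
  match A.act c.mem c.store with
  | .read next =>
      match c.input with
      | [] => .run { c with mem := next none }
      | e :: l => .run { c with mem := next (some e), store := insert e c.store, input := l }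
  | .forget T next => .run { c with mem := next, store := c.store \ T }
  | .eval S r next =>
      if S ⊆ c.store then
        .run { c with
          mem := next
          reg := Function.update c.reg r (O.value S)
          used := max c.used (r + 1)
          calls := c.calls + 1 }
      else .fail
  | .test w yes no =>
      .run { c with mem := if 0 ≤ w.sum (fun i a => a * c.reg i) then yes else no }
  | .indep i S yes no =>
      if S ⊆ c.store then .run { c with mem := if O.isIndep i S then yes else no } else .fail
  | .output S => if S ⊆ c.store then .halt S else .fail

/-- The initial configuration on the stream `σ`. -/
def initial (A : StreamAlg X p) (σ : List X) : StreamConfig X A.Mem where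
  mem := A.start
  store := ∅
  reg := fun _ => 0
  used := 0
  calls := 0
  input := σ

/-- `c` is reached in finitely many steps on the stream `σ`. -/
def Reaches (A : StreamAlg X p) (O : StreamOracles X p) (σ : List X)
    (c : StreamConfig X A.Mem) : Prop :=
  Relation.ReflTransGen (fun c₁ c₂ => A.step O c₁ = .run c₂) (A.initial σ) c

/-- In one pass over `σ`, the algorithm halts (without failing) with output `S`. -/
def Outputs (A : StreamAlg X p) (O : StreamOracles X p) (σ : List X) (S : Finset X) : Prop :=
  ∃ c, A.Reaches O σ c ∧ A.step O c = .halt S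

/-- At all times during the run on `σ`, at most `s` elements and at most `s` real numbers
are stored, the discrete memory occupies at most `b` bits, and at most `q` calls to the value
oracle have been made. -/
def RunsWithin (A : StreamAlg X p) (O : StreamOracles X p) (σ : List X) (s b q : ℕ) : Prop :=
  ∀ c, A.Reaches O σ c →
    c.store.card ≤ s ∧ c.used ≤ s ∧ (A.enc c.mem).length ≤ b ∧ c.calls ≤ q

end StreamAlg

/-! All three algorithms keep a feasible or bounded-degree set of stored elements and give an
arriving element its marginal value `c` with respect to that set. Submodularity makes such weights
useful in both directions. Summed over any part of the stored set they bound its value from below.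
They also bound from above the marginal value with respect to everything ever accepted and, by
curvature, `1 - curvature` times the singleton value. So the value of any competitor `T` is
controlled by weights in two ways: `f T` is at most the value of all accepted elements plus the
weights of `T`, and `(1 - curvature) * f T` is at most the weights of `T` alone.

Matchings: with `φ x = a x - b x / 2`, an edge `uv` is accepted if `c ≥ 2 * (φ u + φ v)`. Then `2φ`
covers every edge seen, so the weights of a matching add up to at most `2 * ∑ φ`. An acceptance at
least doubles `φ` at both ends, hence older edges at a vertex matter geometrically less and six of
them per end suffice. A greedy matching through the stored edges, newest first, recovers `2 / 5` of
the potential that they account for (`MatchingInvariant.accept`, `sum_le_greedyMatching`).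

Hypermatchings and matroids: `x` replaces its conflicts, one per constraint, if `c` is at least `1 +
g` times their total weight `U`. Each seen element is spanned, constraint by constraint, by accepted
elements above suitable thresholds. Integrating ranks over superlevel sets turns this into a bound
on the weight of every independent set (`sum_le_levelRank`, `ExchangeInvariant.sum_weight_le`). The
choice `g = 1` gives `4p`, and `g = √(p (p - 1)) / p` gives the curvature bound; both are run in
parallel and the better solution is returned.

Machine side: a program processes each element by a decision tree of bounded depth, and a machine
only has to remember the program state, the element and the path in that tree. Registers accept
oracle answers only, so a weight is held as two values of `f`. -/

/-! ### Bit strings -/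

/-- A self-delimiting encoding of a pair of bit strings. -/
def bitPair : List Bool → List Bool → List Bool
  | [], m => false :: m
  | b :: l, m => true :: b :: bitPair l m

theorem bitPair_inj : ∀ {l l' m m' : List Bool}, bitPair l m = bitPair l' m' → l = l' ∧ m = m'
  | [], [], _, _, h => ⟨rfl, by simpa [bitPair] using h⟩
  | [], _ :: _, _, _, h => by simp [bitPair] at h
  | _ :: _, [], _, _, h => by simp [bitPair] at h
  | b :: l, b' :: l', m, m', h => by
    simp only [bitPair, List.cons.injEq, true_and] at h
    obtain ⟨h1, h2⟩ := bitPair_inj h.2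
    exact ⟨by rw [h.1, h1], h2⟩

theorem length_bitPair (l m : List Bool) :
    (bitPair l m).length = 2 * l.length + 1 + m.length := by
  induction l with
  | nil => simp [bitPair]; omega
  | cons b l ih => simp [bitPair, ih]; omega

/-- The encoding of a list, given an encoding of its entries. -/
def bitList {α : Type} (enc : α → List Bool) : List α → List Bool
  | [] => []
  | a :: l => bitPair (enc a) (bitList enc l)

theorem bitPair_ne_nil (l m : List Bool) : bitPair l m ≠ [] := by
  cases l <;> simp [bitPair]

theorem bitList_injective {α : Type} {enc : α → List Bool} (h : Function.Injective enc) :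
    Function.Injective (bitList enc) := by
  intro l
  induction l with
  | nil =>
    intro l' hl
    cases l' with
    | nil => rfl
    | cons a l' => exact absurd hl.symm (bitPair_ne_nil _ _)
  | cons a l ih =>
    intro l' hl
    cases l' with
    | nil => exact absurd hl (bitPair_ne_nil _ _)
    | cons a' l' =>
      obtain ⟨h1, h2⟩ := bitPair_inj hl
      rw [h h1, ih h2]

theorem length_bitList_le {α : Type} {enc : α → List Bool} {b : ℕ} {l : List α}
    (h : ∀ a ∈ l, (enc a).length ≤ b) : (bitList enc l).length ≤ l.length * (2 * b + 1) := by
  induction l with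
  | nil => simp [bitList]
  | cons a l ih =>
    have h1 := h a (by simp)
    have h2 := ih fun x hx => h x (by simp [hx])
    simp only [bitList, length_bitPair, List.length_cons, add_mul]
    omega

theorem bits_injective : Function.Injective Nat.bits := by
  intro a b h
  have : Nat.digits 2 a = Nat.digits 2 b := by
    rw [Nat.digits_two_eq_bits, Nat.digits_two_eq_bits, h]
  exact Nat.digits.injective 2 this

theorem length_bits_le {k m : ℕ} (h : k ≤ m) : k.bits.length ≤ Nat.log 2 m + 1 := by
  rw [Nat.size_eq_bits_len, Nat.size_le]
  exact lt_of_le_of_lt h (Nat.lt_pow_succ_log_self (by norm_num) m)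

/-! ### Query trees -/

/-- A decision tree over the oracle and register operations of a streaming machine. -/
inductive QueryTree (X : Type) (p : ℕ) (α : Type) : Type
  | pure (a : α)
  | eval (S : Finset X) (r : ℕ) (k : QueryTree X p α)
  | test (w : ℕ →₀ ℝ) (yes no : QueryTree X p α)
  | indep (i : Fin p) (S : Finset X) (yes no : QueryTree X p α)

namespace QueryTree

variable {X : Type} {p : ℕ} {α β : Type}

/-- Sequential composition. -/
def bind : QueryTree X p α → (α → QueryTree X p β) → QueryTree X p β
  | pure a, g => g a
  | eval S r k, g => eval S r (k.bind g)
  | test w y n, g => test w (y.bind g) (n.bind g)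
  | indep i S y n, g => indep i S (y.bind g) (n.bind g)

/-- The subtree below the branch labelled `b`. -/
def child : QueryTree X p α → Bool → QueryTree X p α
  | pure a, _ => pure a
  | eval _ _ k, _ => k
  | test _ y n, b => if b then y else n
  | indep _ _ y n, b => if b then y else n

/-- The subtree at the end of a path. -/
def descend (t : QueryTree X p α) (path : List Bool) : QueryTree X p α := path.foldl child t

theorem descend_concat (t : QueryTree X p α) (path : List Bool) (b : Bool) :
    t.descend (path ++ [b]) = (t.descend path).child b := by
  simp [descend]

/-- The machine instruction at the root of a tree. -/
def action {Mem : Type} (leaf : α → StreamAction X Mem p) (next : Bool → Mem) :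
    QueryTree X p α → StreamAction X Mem p
  | pure a => leaf a
  | eval S r _ => .eval S r (next true)
  | test w _ _ => .test w (next true) (next false)
  | indep i S _ _ => .indep i S (next true) (next false)

open Classical in
/-- With the elements of `store` stored and registers `reg`, the evaluation of the tree is
legal, takes at most `d` queries, at most `q` of them to the value oracle, writes only to
registers below `R`, and ends with a result and registers that satisfy `Q`. -/
inductive Meets (O : StreamOracles X p) (store : Finset X) (R : ℕ) (Q : α → (ℕ → ℝ) → Prop) :
    ℕ → ℕ → (ℕ → ℝ) → QueryTree X p α → Prop
  | pure {d q reg a} : Q a reg → Meets O store R Q d q reg (.pure a)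
  | eval {d q reg S r k} : S ⊆ store → r < R →
      Meets O store R Q d q (Function.update reg r (O.value S)) k →
      Meets O store R Q (d + 1) (q + 1) reg (.eval S r k)
  | test {d q reg w y n} :
      Meets O store R Q d q reg (if 0 ≤ w.sum (fun i a => a * reg i) then y else n) →
      Meets O store R Q (d + 1) q reg (.test w y n)
  | indep {d q reg i S y n} : S ⊆ store →
      Meets O store R Q d q reg (if O.isIndep i S then y else n) →
      Meets O store R Q (d + 1) q reg (.indep i S y n)

variable {O : StreamOracles X p} {store : Finset X} {R : ℕ}

theorem Meets.mono {Q Q' : α → (ℕ → ℝ) → Prop} {d q d' q' : ℕ} {reg : ℕ → ℝ}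
    {t : QueryTree X p α} (h : Meets O store R Q d q reg t)
    (hQ : ∀ a reg', Q a reg' → Q' a reg') (hd : d ≤ d') (hq : q ≤ q') :
    Meets O store R Q' d' q' reg t := by
  induction h generalizing d' q' with
  | pure h => exact .pure (hQ _ _ h)
  | eval hS hr _ ih =>
    obtain ⟨d', rfl⟩ := Nat.exists_eq_add_of_le' (show 1 ≤ d' by omega)
    obtain ⟨q', rfl⟩ := Nat.exists_eq_add_of_le' (show 1 ≤ q' by omega)
    exact .eval hS hr (ih (by omega) (by omega))
  | test _ ih =>
    obtain ⟨d', rfl⟩ := Nat.exists_eq_add_of_le' (show 1 ≤ d' by omega)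
    exact .test (ih (by omega) hq)
  | indep hS _ ih =>
    obtain ⟨d', rfl⟩ := Nat.exists_eq_add_of_le' (show 1 ≤ d' by omega)
    exact .indep hS (ih (by omega) hq)

theorem Meets.bind {Q : α → (ℕ → ℝ) → Prop} {Q' : β → (ℕ → ℝ) → Prop} {d q d' q' : ℕ}
    {reg : ℕ → ℝ} {t : QueryTree X p α} {g : α → QueryTree X p β}
    (h : Meets O store R Q d q reg t)
    (hg : ∀ a reg', Q a reg' → Meets O store R Q' d' q' reg' (g a)) :
    Meets O store R Q' (d + d') (q + q') reg (t.bind g) := by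
  induction h with
  | pure h => exact (hg _ _ h).mono (fun _ _ h => h) (by omega) (by omega)
  | eval hS hr _ ih =>
    rw [show ∀ a : ℕ, a + 1 + d' = (a + d') + 1 by intro; omega,
      show ∀ a : ℕ, a + 1 + q' = (a + q') + 1 by intro; omega]
    exact .eval hS hr ih
  | test _ ih =>
    rw [show ∀ a : ℕ, a + 1 + d' = (a + d') + 1 by intro; omega]
    refine .test ?_
    split_ifs at ih ⊢ <;> exact ih
  | indep hS _ ih =>
    rw [show ∀ a : ℕ, a + 1 + d' = (a + d') + 1 by intro; omega]
    refine .indep hS ?_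
    split_ifs at ih ⊢ <;> exact ih

end QueryTree

/-! ### Verified runs -/

namespace StreamAlg

variable {X : Type} [DecidableEq X] {p : ℕ}

/-- Every configuration of the run from `c` on satisfies `B`, and the run halts with an output
that satisfies `P`. -/
inductive Safe (A : StreamAlg X p) (O : StreamOracles X p) (B : StreamConfig X A.Mem → Prop)
    (P : Finset X → Prop) : StreamConfig X A.Mem → Prop
  | halt {c S} : B c → A.step O c = .halt S → P S → Safe A O B P c
  | run {c c'} : B c → A.step O c = .run c' → Safe A O B P c' → Safe A O B P c

variable {A : StreamAlg X p} {O : StreamOracles X p} {B : StreamConfig X A.Mem → Prop}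
  {P : Finset X → Prop} {c : StreamConfig X A.Mem}

theorem Safe.bound (h : Safe A O B P c) : B c := by
  cases h <;> assumption

theorem Safe.of_reaches (h : Safe A O B P c) {c' : StreamConfig X A.Mem}
    (hc : Relation.ReflTransGen (fun c₁ c₂ => A.step O c₁ = .run c₂) c c') : Safe A O B P c' := by
  induction hc with
  | refl => exact h
  | tail _ hstep ih =>
    cases ih with
    | halt _ h1 _ => rw [h1] at hstep; cases hstep
    | run _ h1 h2 =>
      rw [h1] at hstep
      cases hstep
      exact h2

theorem Safe.exists_halt (h : Safe A O B P c) :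
    ∃ c' S, Relation.ReflTransGen (fun c₁ c₂ => A.step O c₁ = .run c₂) c c' ∧
      A.step O c' = .halt S ∧ P S := by
  induction h with
  | halt _ h1 h2 => exact ⟨_, _, .refl, h1, h2⟩
  | run _ h1 _ ih =>
    obtain ⟨c', S, h2, h3, h4⟩ := ih
    exact ⟨c', S, .head h1 h2, h3, h4⟩

/-- The tree is never stored: the node is recovered from the path in memory, which grows by one bit
per query. An evaluation has a single child and always appends `true`; its answer goes to a
register. -/
theorem Safe.of_meets {α : Type} {store : Finset X} {R : ℕ} {Q : α → (ℕ → ℝ) → Prop}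
    {d q : ℕ} {reg : ℕ → ℝ} {t t₀ : QueryTree X p α}
    {m : List Bool → A.Mem} {leaf : Finset X → α → StreamAction X A.Mem p}
    (hact : ∀ path store,
      A.act (m path) store = (t₀.descend path).action (leaf store) fun b => m (path ++ [b]))
    {input : List X} {D C : ℕ}
    (hB : ∀ path reg used calls, path.length ≤ D → used ≤ R → calls ≤ C →
      B ⟨m path, store, reg, used, calls, input⟩)
    (hleaf : ∀ path a reg used calls, t₀.descend path = .pure a → Q a reg → path.length ≤ D →
      used ≤ R → calls ≤ C → Safe A O B P ⟨m path, store, reg, used, calls, input⟩)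
    (h : t.Meets O store R Q d q reg) {path : List Bool} (ht : t₀.descend path = t)
    (hd : path.length + d ≤ D) {used calls : ℕ} (hu : used ≤ R) (hc : calls + q ≤ C) :
    Safe A O B P ⟨m path, store, reg, used, calls, input⟩ := by
  induction h generalizing path used calls with
  | pure h => exact hleaf _ _ _ _ _ ht h (by omega) hu (by omega)
  | @eval d q reg S r k hS hr _ ih =>
    refine .run (hB _ _ _ _ (by omega) hu (by omega))
      (c' := ⟨m (path ++ [true]), store, Function.update reg r (O.value S), max used (r + 1),
        calls + 1, input⟩) ?_ (ih ?_ ?_ ?_ ?_)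
    · simp only [step, hact, ht, QueryTree.action, if_pos hS]
    · rw [QueryTree.descend_concat, ht]; rfl
    · simp; omega
    · omega
    · omega
  | @test d q reg w y n _ ih =>
    refine .run (hB _ _ _ _ (by omega) hu (by omega))
      (c' := ⟨m (path ++ [decide (0 ≤ w.sum fun i a => a * reg i)]), store, reg, used,
        calls, input⟩) ?_ (ih ?_ ?_ hu hc)
    · simp only [step, hact, ht, QueryTree.action]
      split_ifs with h <;> simp [h]
    · rw [QueryTree.descend_concat, ht]
      by_cases h : 0 ≤ w.sum fun i a => a * reg i <;> simp [h, QueryTree.child]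
    · simp; omega
  | @indep d q reg i S y n hS _ ih =>
    classical
    refine .run (hB _ _ _ _ (by omega) hu (by omega))
      (c' := ⟨m (path ++ [decide (O.isIndep i S)]), store, reg, used,
        calls, input⟩) ?_ (ih ?_ ?_ hu hc)
    · simp only [step, hact, ht, QueryTree.action, if_pos hS]
      split_ifs with h <;> simp [h]
    · rw [QueryTree.descend_concat, ht]
      by_cases h : O.isIndep i S <;> simp [h, QueryTree.child]
    · simp; omega

end StreamAlg

/-! ### Streaming programs -/

/-- A streaming program: it processes each stream element by a query tree that computes the
next state, and then stores exactly the elements that the new state asks to keep. -/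
structure StreamProgram (X : Type) (p : ℕ) where
  State : Type
  enc : State → List Bool
  enc_injective : Function.Injective enc
  start : State
  keep : State → Finset X
  item : State → X → QueryTree X p State
  final : State → QueryTree X p (Finset X)

/-- The memory of the machine that executes a program: between two elements, or at some node
of the query tree for an element, or at some node of the final query tree. -/
inductive ProgramMem (X State : Type) : Type
  | idle (s : State)
  | busy (s : State) (x : X) (path : List Bool)
  | closing (s : State) (path : List Bool)

namespace StreamProgram

variable {X : Type} [DecidableEq X] {p : ℕ}

/-- The bit string for a memory content. -/
def encMem {State : Type} (enc : State → List Bool) (encX : X → List Bool) :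
    ProgramMem X State → List Bool
  | .idle s => false :: false :: enc s
  | .busy s x path => true :: bitPair (enc s) (bitPair (encX x) path)
  | .closing s path => false :: true :: bitPair (enc s) path

omit [DecidableEq X] in
theorem encMem_injective {State : Type} {enc : State → List Bool} {encX : X → List Bool}
    (h : Function.Injective enc) (hX : Function.Injective encX) :
    Function.Injective (encMem enc encX) := by
  intro a b hab
  cases a <;> cases b <;>
    simp only [encMem, List.cons.injEq, true_and, reduceCtorEq, false_and] at hab
  · rw [h hab]
  · obtain ⟨h1, h2⟩ := bitPair_inj hab
    obtain ⟨h3, h4⟩ := bitPair_inj h2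
    rw [h h1, hX h3, h4]
  · obtain ⟨h1, h2⟩ := bitPair_inj hab
    rw [h h1, h2]

/-- The machine that executes a program. -/
def toAlg (Pr : StreamProgram X p) (encX : X → List Bool) (hX : Function.Injective encX) :
    StreamAlg X p where
  Mem := ProgramMem X Pr.State
  enc := encMem Pr.enc encX
  enc_injective := encMem_injective Pr.enc_injective hX
  start := .idle Pr.start
  act m store := match m with
    | .idle s => .read fun
      | some x => .busy s x []
      | none => .closing s []
    | .busy s x path => ((Pr.item s x).descend path).action
        (fun s' => .forget (store \ Pr.keep s') (.idle s')) fun b => .busy s x (path ++ [b])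
    | .closing s path => ((Pr.final s).descend path).action
        (fun S => .output S) fun b => .closing s (path ++ [b])

/-- Reduces a machine run to one invariant of the program between elements. The factors `2` in the
memory bound come from the self-delimiting `bitPair`, which doubles its first argument; `d` is the
longest path. -/
theorem toAlg_correct (Pr : StreamProgram X p) {encX : X → List Bool}
    (hX : Function.Injective encX) {O : StreamOracles X p} {σ : List X}
    {Inv : List X → Pr.State → (ℕ → ℝ) → Prop} {P : Finset X → Prop} {sz bS bX d q : ℕ}
    (hkeep : Pr.keep Pr.start = ∅)
    (h0 : Inv [] Pr.start fun _ => 0)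
    (hitem : ∀ l x r, σ = l ++ x :: r → ∀ s reg, Inv l s reg →
      (Pr.item s x).Meets O (insert x (Pr.keep s)) sz
        (fun s' reg' => Pr.keep s' ⊆ insert x (Pr.keep s) ∧ Inv (l ++ [x]) s' reg') d q reg)
    (hfin : ∀ s reg, Inv σ s reg → (Pr.final s).Meets O (Pr.keep s) sz
      (fun S _ => S ⊆ Pr.keep s ∧ P S) d q reg)
    (hInv : ∀ l s reg, Inv l s reg → (Pr.keep s).card + 1 ≤ sz ∧ (Pr.enc s).length ≤ bS)
    (hbX : ∀ x ∈ σ, (encX x).length ≤ bX) :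
    (Pr.toAlg encX hX).RunsWithin O σ sz (2 * bS + 2 * bX + d + 5) (q * (σ.length + 1)) ∧
      ∃ M, (Pr.toAlg encX hX).Outputs O σ M ∧ P M := by
  let B : StreamConfig X (Pr.toAlg encX hX).Mem → Prop := fun c =>
    c.store.card ≤ sz ∧ c.used ≤ sz ∧
      ((Pr.toAlg encX hX).enc c.mem).length ≤ 2 * bS + 2 * bX + d + 5 ∧
      c.calls ≤ q * (σ.length + 1)
  have key : ∀ (r l : List X), σ = l ++ r → ∀ s reg used calls, Inv l s reg → used ≤ sz →
      calls ≤ q * l.length →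
      StreamAlg.Safe (Pr.toAlg encX hX) O B P ⟨.idle s, Pr.keep s, reg, used, calls, r⟩ := by
    intro r
    induction r with
    | nil =>
      intro l hl s reg used calls hI hu hc
      obtain ⟨hs1, hs2⟩ := hInv _ _ _ hI
      rw [List.append_nil] at hl
      subst hl
      refine .run (c' := ⟨.closing s [], Pr.keep s, reg, used, calls, []⟩) ?_ rfl ?_
      · refine ⟨by simp; omega, hu, ?_, ?_⟩
        · simp [toAlg, encMem]; omega
        · simp [mul_add]; omega
      · refine StreamAlg.Safe.of_meets (A := Pr.toAlg encX hX) (t₀ := Pr.final s)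
          (leaf := fun _ S => StreamAction.output S) (m := fun path => ProgramMem.closing s path)
          (D := d) (C := q * (σ.length + 1)) (path := []) (fun _ _ => rfl) ?_ ?_ (hfin s reg hI)
          rfl (by simp) hu
          (by simp [mul_add]; omega)
        · intro path reg used calls hp hu hc
          refine ⟨by simp; omega, hu, ?_, hc⟩
          simp [toAlg, encMem, length_bitPair]; omega
        · intro path S reg used calls hp hQ hpl hu hc
          refine .halt (S := S) ?_ ?_ hQ.2
          · refine ⟨by simp; omega, hu, ?_, hc⟩
            simp [toAlg, encMem, length_bitPair]; omega
          · simp only [StreamAlg.step, toAlg, hp, QueryTree.action, if_pos hQ.1]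
    | cons x r ih =>
      intro l hl s reg used calls hI hu hc
      obtain ⟨hs1, hs2⟩ := hInv _ _ _ hI
      have hxb := hbX x (by simp [hl])
      have hlen : σ.length = l.length + 1 + r.length := by simp [hl]; omega
      have hq : q * l.length + q ≤ q * (σ.length + 1) := by
        calc q * l.length + q = q * (l.length + 1) := by ring
          _ ≤ _ := Nat.mul_le_mul_left _ (by omega)
      have hcard : (insert x (Pr.keep s)).card ≤ sz := (Finset.card_insert_le _ _).trans hs1
      refine .run (c' := ⟨.busy s x [], insert x (Pr.keep s), reg, used, calls, r⟩) ?_ rfl ?_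
      · refine ⟨by simp; omega, hu, ?_, ?_⟩
        · simp [toAlg, encMem]; omega
        · simp; omega
      · refine StreamAlg.Safe.of_meets (A := Pr.toAlg encX hX) (t₀ := Pr.item s x)
          (leaf := fun store s' => StreamAction.forget (store \ Pr.keep s')
            (ProgramMem.idle s'))
          (m := fun path => ProgramMem.busy s x path)
          (D := d) (C := q * (l.length + 1)) (R := sz) (path := []) (fun _ _ => rfl) ?_ ?_
          (hitem l x r hl s reg hI) rfl (by simp) hu (by rw [mul_add]; omega)
        · intro path reg used calls hp hu hc
          refine ⟨hcard, hu, ?_, ?_⟩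
          · simp [toAlg, encMem, length_bitPair]; omega
          · rw [mul_add] at hc; simp; omega
        · intro path s' reg' used calls hp hQ hpl hu hc
          refine .run (c' := ⟨ProgramMem.idle s', Pr.keep s', reg', used, calls, r⟩) ?_ ?_ ?_
          · refine ⟨hcard, hu, ?_, ?_⟩
            · simp [toAlg, encMem, length_bitPair]; omega
            · rw [mul_add] at hc; simp; omega
          · simp only [StreamAlg.step, toAlg, hp, QueryTree.action,
              Finset.sdiff_sdiff_eq_self hQ.1]
          · exact ih (l ++ [x]) (by simp [hl]) s' reg' used calls hQ.2 hu (by simpa using hc)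
  have hsafe := key σ [] rfl Pr.start (fun _ => 0) 0 0 h0 (Nat.zero_le _) (Nat.zero_le _)
  rw [hkeep] at hsafe
  refine ⟨fun c hc => (hsafe.of_reaches hc).bound, ?_⟩
  obtain ⟨c, S, h1, h2, h3⟩ := hsafe.exists_halt
  exact ⟨S, ⟨c, h1, h2⟩, h3⟩

end StreamProgram

/-! ### Submodular functions -/

namespace IsMonoSubmodular

variable {X : Type} [DecidableEq X] {E : Finset X} {f : Finset X → ℝ}

theorem marginal_le (hf : IsMonoSubmodular E f) {A B : Finset X} {x : X} (hAB : A ⊆ B)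
    (hB : B ⊆ E) (hx : x ∈ E) (hxB : x ∉ B) :
    f (insert x B) - f B ≤ f (insert x A) - f A := by
  have h := hf.submod (insert x A) B (Finset.insert_subset hx (hAB.trans hB)) hB
  rw [Finset.insert_union, Finset.union_eq_right.2 hAB, Finset.insert_inter_of_notMem hxB,
    Finset.inter_eq_left.2 hAB] at h
  linarith

theorem marginal_nonneg (hf : IsMonoSubmodular E f) {A : Finset X} {x : X} (hA : A ⊆ E)
    (hx : x ∈ E) : 0 ≤ f (insert x A) - f A :=
  sub_nonneg.2 (hf.mono _ _ (Finset.subset_insert _ _) (Finset.insert_subset hx hA))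

theorem marginal_le' (hf : IsMonoSubmodular E f) {A B : Finset X} {x : X} (hAB : A ⊆ B)
    (hB : B ⊆ E) (hx : x ∈ E) :
    f (insert x B) - f B ≤ f (insert x A) - f A := by
  by_cases hxB : x ∈ B
  · rw [Finset.insert_eq_of_mem hxB, sub_self]
    exact hf.marginal_nonneg (hAB.trans hB) hx
  · exact hf.marginal_le hAB hB hx hxB

theorem le_add_sum (hf : IsMonoSubmodular E f) {A T : Finset X} (hA : A ⊆ E) (hT : T ⊆ E) :
    f T ≤ f A + ∑ o ∈ T, (f (insert o A) - f A) := by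
  refine (hf.mono T (A ∪ T) Finset.subset_union_right (Finset.union_subset hA hT)).trans ?_
  induction T using Finset.induction_on with
  | empty => simp
  | insert x T hx ih =>
    have hT' := (Finset.subset_insert x T).trans hT
    have h := hf.marginal_le' (x := x) (Finset.subset_union_left (s₁ := A) (s₂ := T))
      (Finset.union_subset hA hT') (hT (Finset.mem_insert_self _ _))
    rw [Finset.sum_insert hx, Finset.union_insert]
    linarith [ih hT']

theorem le_sum_singleton (hf : IsMonoSubmodular E f) {T : Finset X} (hT : T ⊆ E) :
    f T ≤ ∑ o ∈ T, f {o} := by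
  simpa [hf.proper] using hf.le_add_sum (Finset.empty_subset E) hT

/-- The infimum is attained if some singleton has positive value. Otherwise all singleton values
vanish and the inequality is monotonicity, whatever the constant. -/
theorem curvatureBound_curvature (hf : IsMonoSubmodular E f) :
    CurvatureBound E f (curvature E f) := by
  by_cases h : ∃ x ∈ E, 0 < f {x}
  · obtain ⟨x, hx, hpos⟩ := h
    exact (curvature_isLeast hf hx hpos).1
  · push Not at h
    intro A hA e he
    have he' := (Finset.mem_sdiff.1 he).1
    have h0 : f {e} = 0 :=
      le_antisymm (h e he') (hf.nonneg _ (Finset.singleton_subset_iff.2 he'))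
    rw [h0, mul_zero, Finset.union_comm, ← Finset.insert_eq]
    exact hf.marginal_nonneg hA he'

theorem one_sub_curvature_mul_le (hf : IsMonoSubmodular E f) {T : Finset X} (hT : T ⊆ E) :
    (1 - curvature E f) * f T ≤ ∑ o ∈ T, (1 - curvature E f) * f {o} := by
  rw [← Finset.mul_sum]
  refine mul_le_mul_of_nonneg_left (hf.le_sum_singleton hT) (sub_nonneg.2 ?_)
  -- The constant `1` is admissible by monotonicity, so the curvature is at most `1`.
  refine csInf_le ⟨0, fun c hc => hc.1⟩ ⟨zero_le_one, le_rfl, fun A hA e he => ?_⟩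
  rw [sub_self, zero_mul, Finset.union_comm, ← Finset.insert_eq]
  exact hf.marginal_nonneg hA (Finset.mem_sdiff.1 he).1

end IsMonoSubmodular

/-- The ratio is a minimum, so two independent estimates suffice; for curvature `1` the second one
says nothing and is not needed. -/
theorem isApproxMax_of_bounds {X : Type} [DecidableEq X] {E : Finset X} {f : Finset X → ℝ}
    {Ind : Finset X → Prop} {I : Finset X} {a b : ℝ}
    (ha : 0 < a) (hb : 0 < b) (hIE : I ⊆ E) (hI : Ind I)
    (h1 : ∀ T ⊆ E, Ind T → f T ≤ a * f I)
    (h2 : ∀ T ⊆ E, Ind T → (1 - curvature E f) * f T ≤ b * f I) :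
    IsApproxMax E Ind f (curvatureRatio a b (curvature E f)) I := by
  refine ⟨hIE, hI, fun T hT hTI => ?_⟩
  have e1 := h1 T hT hTI
  have e2 := h2 T hT hTI
  unfold curvatureRatio
  split_ifs with hc
  · have hc' : 0 < 1 - curvature E f := by linarith
    rcases min_cases a (b / (1 - curvature E f)) with h | h
    · rw [h.1, inv_mul_le_iff₀ ha]; exact e1
    · rw [h.1, inv_mul_le_iff₀ (by positivity), div_mul_eq_mul_div, le_div_iff₀ hc']
      linarith
  · rw [inv_mul_le_iff₀ ha]; exact e1

/-! ### Greedy matchings in a list of edges -/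

section GreedyMatching

variable {V : Type}

/-- Two edges share a vertex. -/
def EdgesTouch (d e : Sym2 V) : Prop := ∃ x, x ∈ d ∧ x ∈ e

open Classical in
/-- The edges of a list that do not touch `d`. -/
noncomputable def edgesAwayFrom (d : Sym2 V) (D : List (Sym2 V)) : List (Sym2 V) :=
  D.filter fun e => ¬ EdgesTouch d e

theorem edgesAwayFrom_sublist (d : Sym2 V) (D : List (Sym2 V)) :
    (edgesAwayFrom d D).Sublist D := List.filter_sublist

/-- The matching obtained from a list of edges by going through the list and taking every edge
that does not touch an edge taken before. -/
noncomputable def greedyMatching : List (Sym2 V) → List (Sym2 V)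
  | [] => []
  | d :: D => d :: greedyMatching (edgesAwayFrom d D)
termination_by D => D.length
decreasing_by exact Nat.lt_succ_of_le (edgesAwayFrom_sublist d D).length_le

open Classical in
/-- Each edge `d` of the list satisfies `h d + ∑ h e ≤ 5 / 2 * w d`, where the sum is over the
edges behind `d` that touch it. -/
def ChargesBehind (w h : Sym2 V → ℝ) : List (Sym2 V) → Prop
  | [] => True
  | d :: D => h d + ((D.filter fun e => EdgesTouch d e).map h).sum ≤ 5 / 2 * w d ∧
      ChargesBehind w h D

theorem sum_map_le_of_sublist {α : Type} {h : α → ℝ} (h0 : ∀ e, 0 ≤ h e) {L D : List α}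
    (hLD : L.Sublist D) : (L.map h).sum ≤ (D.map h).sum :=
  (hLD.map h).sum_le_sum fun a ha => by
    obtain ⟨e, _, rfl⟩ := List.mem_map.1 ha
    exact h0 e

open Classical in
theorem ChargesBehind.sublist {w h : Sym2 V → ℝ} (h0 : ∀ e, 0 ≤ h e) {L D : List (Sym2 V)}
    (hLD : L.Sublist D) (hD : ChargesBehind w h D) : ChargesBehind w h L := by
  induction hLD with
  | slnil => trivial
  | cons _ _ ih => exact ih hD.2
  | cons_cons d hs ih =>
    refine ⟨?_, ih hD.2⟩
    have := sum_map_le_of_sublist h0 (hs.filter fun e => decide (EdgesTouch d e))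
    linarith [hD.1]

theorem ChargesBehind.congr {w h w' h' : Sym2 V → ℝ} {D : List (Sym2 V)}
    (hw : ∀ d ∈ D, w' d = w d) (hh : ∀ d ∈ D, h' d = h d) (hD : ChargesBehind w h D) :
    ChargesBehind w' h' D := by
  induction D with
  | nil => trivial
  | cons d D ih =>
    refine ⟨?_, ih (fun e he => hw e (by simp [he])) (fun e he => hh e (by simp [he])) hD.2⟩
    rw [hw d (by simp), hh d (by simp), List.map_congr_left (g := h)
      fun e he => hh e (List.mem_cons_of_mem _ (List.mem_of_mem_filter he))]
    exact hD.1

theorem greedyMatching_sublist (D : List (Sym2 V)) : (greedyMatching D).Sublist D := by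
  induction D using greedyMatching.induct with
  | case1 => rw [greedyMatching]
  | case2 d D ih =>
    rw [greedyMatching]
    exact (ih.trans (edgesAwayFrom_sublist d D)).cons_cons d

theorem pairwise_greedyMatching (D : List (Sym2 V)) :
    (greedyMatching D).Pairwise fun d e => ¬ EdgesTouch d e := by
  induction D using greedyMatching.induct with
  | case1 => rw [greedyMatching]; exact .nil
  | case2 d D ih =>
    rw [greedyMatching]
    refine List.pairwise_cons.2 ⟨fun e he => ?_, ih⟩
    simpa using (List.mem_filter.1 ((greedyMatching_sublist _).subset he)).2

theorem isGraphMatching_greedyMatching [DecidableEq V] (D : List (Sym2 V)) :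
    IsGraphMatching (greedyMatching D).toFinset := by
  intro e he e' he' hne v hv hv'
  have : Std.Symm fun d e : Sym2 V => ¬ EdgesTouch d e :=
    ⟨fun _ _ h ⟨x, h1, h2⟩ => h ⟨x, h2, h1⟩⟩
  exact (pairwise_greedyMatching D).forall (List.mem_toFinset.1 he) (List.mem_toFinset.1 he') hne
    ⟨v, hv, hv'⟩

-- A chosen edge pays for itself and for the later entries of the list that it blocks. The entries
-- it does not touch form a sublist, where the charging condition persists because `h ≥ 0`.
open Classical in
theorem sum_le_greedyMatching {w h : Sym2 V → ℝ} (h0 : ∀ e, 0 ≤ h e) {D : List (Sym2 V)}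
    (hD : ChargesBehind w h D) :
    (D.map h).sum ≤ 5 / 2 * ((greedyMatching D).map w).sum := by
  induction D using greedyMatching.induct with
  | case1 => simp [greedyMatching]
  | case2 d D ih =>
    rw [greedyMatching]
    have h1 := ih (hD.2.sublist h0 (edgesAwayFrom_sublist d D))
    have h2 := hD.1
    have h3 := List.sum_map_filter_add_sum_map_filter_not (EdgesTouch d) h D
    simp only [List.map_cons, List.sum_cons]
    simp only [edgesAwayFrom] at h1 h2 h3 ⊢
    linarith

end GreedyMatching

/-! ### Streaming matchings: vertex potentials -/

section MatchingPotential

variable {V : Type} [DecidableEq V]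

/-- The edges of a list at the vertex `x`. -/
def edgesAt (D : List (Sym2 V)) (x : V) : List (Sym2 V) := D.filter fun d => decide (x ∈ d)

theorem mem_edgesAt {D : List (Sym2 V)} {x : V} {d : Sym2 V} :
    d ∈ edgesAt D x ↔ d ∈ D ∧ x ∈ d := by
  simp [edgesAt]

/-- Store the new edge `s(u, v)`, and keep only the six most recent stored edges at each of its
ends. -/
def pushEdge (D : List (Sym2 V)) (u v : V) : List (Sym2 V) :=
  s(u, v) :: D.filter fun d => decide (d ∉ (edgesAt D u).drop 6 ∧ d ∉ (edgesAt D v).drop 6)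

/-- The function `a` with the values at `u` and `v` replaced. -/
def setPair {α : Type} (a : V → α) (u v : V) (b c : α) : V → α :=
  fun x => if x = u then b else if x = v then c else a x

/-- The potential of a vertex: the weight of the last edge accepted there, minus half of the
weight that the other end of this edge had before. -/
noncomputable def vertexPotential (a b : V → ℝ) (x : V) : ℝ := a x - b x / 2

/-- The invariant of the streaming matching algorithm on the processed part `l` of the stream.
The list `D` holds the stored edges (most recent first) and `Acc` all accepted edges; `w e` is
the weight of `e` on arrival, and `h e` is the increase of the total potential due to `e`. -/
structure MatchingInvariant [Fintype V] (E : Finset (Sym2 V)) (f : Finset (Sym2 V) → ℝ)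
    (l D : List (Sym2 V)) (Acc : Finset (Sym2 V)) (a b : V → ℝ) (w h : Sym2 V → ℝ) : Prop where
  nodup : D.Nodup
  stored_subset : D.toFinset ⊆ Acc
  acc_subset : Acc ⊆ l.toFinset
  b_nonneg : ∀ x, 0 ≤ b x
  b_le : ∀ x, b x ≤ a x
  h_nonneg : ∀ e, 0 ≤ h e
  degree_le : ∀ x, (edgesAt D x).length ≤ 7
  tail_le : ∀ x j, (((edgesAt D x).drop j).map h).sum ≤ 5 / 2 / 2 ^ j * vertexPotential a b x
  charges : ChargesBehind w h D
  loss : (1 - 5 / 256) * ∑ x, vertexPotential a b x ≤ (D.map h).sum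
  weight_le : ∀ A ⊆ D.toFinset, ∑ e ∈ A, w e ≤ f A
  value_le : f Acc ≤ ∑ x, vertexPotential a b x
  marginal_le : ∀ u v, s(u, v) ∈ l → f (insert s(u, v) Acc) - f Acc ≤
    2 * (vertexPotential a b u + vertexPotential a b v)
  singleton_le : ∀ c, CurvatureBound E f c → ∀ u v, s(u, v) ∈ l → (1 - c) * f {s(u, v)} ≤
    2 * (vertexPotential a b u + vertexPotential a b v)

/-- Made for covers of `D` by several lists that may overlap, such as the edges at the two ends of
an edge: repetitions on the right only help. -/
theorem sum_map_le_of_forall_mem {α : Type} [DecidableEq α] {h : α → ℝ}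
    (h0 : ∀ e, 0 ≤ h e) {D L : List α} (hD : D.Nodup) (hsub : ∀ d ∈ D, d ∈ L) :
    (D.map h).sum ≤ (L.map h).sum := by
  obtain ⟨L', h1, h2⟩ := hD.subperm hsub
  rw [← (h1.map h).sum_eq]
  exact sum_map_le_of_sublist h0 h2

theorem edgesAt_pushEdge_of_ne {D : List (Sym2 V)} {u v x : V} (hu : x ≠ u) (hv : x ≠ v) :
    (edgesAt (pushEdge D u v) x).Sublist (edgesAt D x) := by
  rw [pushEdge, edgesAt, List.filter_cons_of_neg (by simp [hu, hv])]
  exact List.filter_sublist.filter _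

/-- The edges at an end of the new edge. -/
theorem edgesAt_pushEdge {D : List (Sym2 V)} {u v x : V} (hx : x = u ∨ x = v) :
    ∃ L, edgesAt (pushEdge D u v) x = s(u, v) :: L ∧ L.Sublist (edgesAt D x) ∧
      ∀ d ∈ L, d ∉ (edgesAt D x).drop 6 := by
  refine ⟨edgesAt (D.filter fun d => decide (d ∉ (edgesAt D u).drop 6 ∧
    d ∉ (edgesAt D v).drop 6)) x, ?_, List.filter_sublist.filter _, ?_⟩
  · rw [pushEdge, edgesAt, List.filter_cons_of_pos (by simpa using hx)]; rfl
  · intro d hd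
    rw [mem_edgesAt, List.mem_filter, decide_eq_true_eq] at hd
    rcases hx with rfl | rfl
    · exact hd.1.2.1
    · exact hd.1.2.2

/-! ### Preservation of the matching invariant and the approximation ratio -/

namespace MatchingInvariant

variable [Fintype V] {E : Finset (Sym2 V)} {f : Finset (Sym2 V) → ℝ}
  {l D : List (Sym2 V)} {Acc : Finset (Sym2 V)} {a b : V → ℝ} {w h : Sym2 V → ℝ}

theorem nil (hf : IsMonoSubmodular E f) :
    MatchingInvariant E f [] [] ∅ (fun _ : V => 0) (fun _ => 0) (fun _ => 0) (fun _ => 0) where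
  nodup := List.nodup_nil
  stored_subset := by simp
  acc_subset := by simp
  b_nonneg := by simp
  b_le := by simp
  h_nonneg := by simp
  degree_le := by simp [edgesAt]
  tail_le := by simp [edgesAt, vertexPotential]
  charges := trivial
  loss := by simp [vertexPotential]
  weight_le := by
    intro A hA
    rw [List.toFinset_nil, Finset.subset_empty] at hA
    simp [hA, hf.proper]
  value_le := by simp [vertexPotential, hf.proper]
  marginal_le := by simp
  singleton_le := by simp

/-- The marginal value with respect to the stored edges dominates both the one with respect to `Acc`
and, by curvature, the scaled singleton value. Being below the threshold is exactly what the cover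
by `2φ` needs. -/
theorem reject (hf : IsMonoSubmodular E f) (hI : MatchingInvariant E f l D Acc a b w h)
    {u v : V} (hl : (l ++ [s(u, v)]).toFinset ⊆ E) (hnew : s(u, v) ∉ l)
    (hw : f (insert s(u, v) D.toFinset) - f D.toFinset <
      2 * (vertexPotential a b u + vertexPotential a b v)) :
    MatchingInvariant E f (l ++ [s(u, v)]) D Acc a b w h := by
  have hlE : l.toFinset ⊆ E := fun x hx => hl (by simp_all)
  have hE : s(u, v) ∈ E := hl (by simp)
  have hsym : ∀ u' v', s(u', v') = s(u, v) →
      vertexPotential a b u' + vertexPotential a b v' =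
        vertexPotential a b u + vertexPotential a b v := by
    intro u' v' h
    rcases Sym2.eq_iff.1 h with ⟨rfl, rfl⟩ | ⟨rfl, rfl⟩
    · rfl
    · exact add_comm _ _
  have hDl := hI.stored_subset.trans hI.acc_subset
  have hnD : s(u, v) ∉ D.toFinset := fun h => hnew (List.mem_toFinset.1 (hDl h))
  refine { hI with acc_subset := ?_, marginal_le := ?_, singleton_le := ?_ }
  · exact hI.acc_subset.trans fun x hx => by simp_all
  · intro u' v' hm
    rcases List.mem_append.1 hm with hm | hm
    · exact hI.marginal_le u' v' hm
    · have he := List.mem_singleton.1 hm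
      rw [he, hsym u' v' he]
      exact (hf.marginal_le' hI.stored_subset (hI.acc_subset.trans hlE) hE).trans hw.le
  · intro c hc u' v' hm
    rcases List.mem_append.1 hm with hm | hm
    · exact hI.singleton_le c hc u' v' hm
    · have he := List.mem_singleton.1 hm
      rw [he, hsym u' v' he]
      have := hc D.toFinset (hDl.trans hlE) s(u, v) (Finset.mem_sdiff.2 ⟨hE, hnD⟩)
      rw [Finset.union_comm, ← Finset.insert_eq] at this
      exact this.trans hw.le

/-- Everything rests on `c ≥ 2 * (φ u + φ v)` and `0 ≤ b ≤ a`. These give `c ≥ a u + a v` (so `b ≤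
a` survives) and `c ≤ H`, where `H` is the increase of the total potential. They also make the
potential at each end at least double. -/
theorem accept (hf : IsMonoSubmodular E f) (hI : MatchingInvariant E f l D Acc a b w h)
    {u v : V} (huv : u ≠ v) (hl : (l ++ [s(u, v)]).toFinset ⊆ E) (hnew : s(u, v) ∉ l) {c : ℝ}
    (hc : c = f (insert s(u, v) D.toFinset) - f D.toFinset)
    (hw : 2 * (vertexPotential a b u + vertexPotential a b v) ≤ c) :
    MatchingInvariant E f (l ++ [s(u, v)]) (pushEdge D u v) (insert s(u, v) Acc)
      (setPair a u v c c) (setPair b u v (a v) (a u)) (Function.update w s(u, v) c)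
      (Function.update h s(u, v) (2 * c - (a u + a v) / 2 -
        vertexPotential a b u - vertexPotential a b v)) := by
  set e := s(u, v) with he
  set H := 2 * c - (a u + a v) / 2 - vertexPotential a b u - vertexPotential a b v with hH
  set h' := Function.update h e H with hh'
  set φ := vertexPotential a b with hφ
  set φ' := vertexPotential (setPair a u v c c) (setPair b u v (a v) (a u)) with hφ'
  have hlE : l.toFinset ⊆ E := fun x hx => hl (by simp_all)
  have hE : e ∈ E := hl (by simp)
  have hDl := hI.stored_subset.trans hI.acc_subset
  have hAE := hI.acc_subset.trans hlE
  have hnA : e ∉ Acc := fun h => hnew (List.mem_toFinset.1 (hI.acc_subset h))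
  have hnD : e ∉ D.toFinset := fun h => hnA (hI.stored_subset h)
  have hnD' : ∀ d ∈ D, d ≠ e := fun d hd h => hnD (by rw [← h]; exact List.mem_toFinset.2 hd)
  have hbu := hI.b_nonneg u
  have hbv := hI.b_nonneg v
  have hau := hI.b_le u
  have hav := hI.b_le v
  have eu : φ u = a u - b u / 2 := rfl
  have ev : φ v = a v - b v / 2 := rfl
  have eu' : φ' u = c - a v / 2 := by simp [hφ', vertexPotential, setPair]
  have ev' : φ' v = c - a u / 2 := by simp [hφ', vertexPotential, setPair, huv.symm]
  have ex' : ∀ x, x ≠ u → x ≠ v → φ' x = φ x := by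
    intro x h1 h2
    simp [hφ', hφ, vertexPotential, setPair, h1, h2]
  have hφ0 : ∀ x, 0 ≤ φ x := fun x => by
    have := hI.b_nonneg x
    have := hI.b_le x
    simp only [hφ, vertexPotential]; linarith
  have hsum : ∑ x, φ' x = ∑ x, φ x + H := by
    have h1 : ∀ g : V → ℝ, ∑ x, g x = g u + (g v + ∑ x ∈ (Finset.univ.erase u).erase v, g x) := by
      intro g
      rw [Finset.add_sum_erase _ _ (by simp [huv.symm]), Finset.add_sum_erase _ _ (by simp)]
    rw [h1 φ', h1 φ, eu', ev', Finset.sum_congr rfl fun x hx => ex' x (by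
      simp at hx; exact hx.2) (by simp at hx; exact hx.1)]
    rw [hH]; ring
  have hcH : c ≤ H := by rw [hH]; linarith
  have hH0 : 0 ≤ H := by linarith [hφ0 u, hφ0 v]
  have hh0 : ∀ d, 0 ≤ h' d := fun d => by
    by_cases hd : d = e
    · rw [hd, hh', Function.update_self]; exact hH0
    · rw [hh', Function.update_of_ne hd]; exact hI.h_nonneg d
  have hmap : ∀ L : List (Sym2 V), (∀ d ∈ L, d ∈ D) → L.map h' = L.map h := fun L hL =>
    List.map_congr_left fun d hd => Function.update_of_ne (hnD' d (hL d hd)) _ _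
  -- For `x = u`, inserting the threshold for `c` leaves a slack of at least `3/2 * a v - b v` in
  -- the first inequality and `5/4 * a v - b v + b u / 4` in the second.
  have hstep : ∀ x, x = u ∨ x = v → 2 * φ x ≤ φ' x ∧ H ≤ 5 / 2 * (φ' x - φ x) := by
    rintro x (rfl | rfl)
    · rw [eu', hH]
      constructor <;> linarith
    · rw [ev', hH]
      constructor <;> linarith
  have hmono : ∀ x, φ x ≤ φ' x := fun x => by
    by_cases hx : x = u ∨ x = v
    · linarith [(hstep x hx).1, hφ0 x]
    · push Not at hx
      rw [ex' x hx.1 hx.2]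
  set F := D.filter fun d => decide (d ∉ (edgesAt D u).drop 6 ∧ d ∉ (edgesAt D v).drop 6) with hF
  have hpush : pushEdge D u v = e :: F := rfl
  have hFD : F.Sublist D := List.filter_sublist
  have htail : ∀ x j, (((edgesAt D x).drop j).map h).sum ≤ 5 / 2 / 2 ^ j * φ x := hI.tail_le
  have hsym : ∀ u' v', s(u', v') = e → φ' u' + φ' v' = φ' u + φ' v := by
    intro u' v' h
    rcases Sym2.eq_iff.1 h with ⟨rfl, rfl⟩ | ⟨rfl, rfl⟩
    · rfl
    · exact add_comm _ _
  refine ⟨?_, ?_, ?_, ?_, ?_, hh0, ?_, ?_, ?_, ?_, ?_, ?_, ?_, ?_⟩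
  · rw [hpush]
    exact List.nodup_cons.2 ⟨fun h => hnD (List.mem_toFinset.2 (hFD.subset h)),
      hI.nodup.sublist hFD⟩
  · rw [hpush, List.toFinset_cons]
    refine Finset.insert_subset_insert _ (Finset.Subset.trans ?_ hI.stored_subset)
    exact fun d hd => List.mem_toFinset.2 (hFD.subset (List.mem_toFinset.1 hd))
  · intro d hd
    rcases Finset.mem_insert.1 hd with rfl | hd
    · simp
    · have := List.mem_toFinset.1 (hI.acc_subset hd)
      simp [this]
  · intro x
    unfold setPair
    split_ifs
    · linarith
    · linarith
    · exact hI.b_nonneg x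
  · intro x
    unfold setPair
    split_ifs
    · linarith
    · linarith
    · exact hI.b_le x
  · intro x
    by_cases hx : x = u ∨ x = v
    · obtain ⟨L, h1, h2, h3⟩ := edgesAt_pushEdge (D := D) hx
      rw [h1, List.length_cons]
      have hnd : L.Nodup := (hI.nodup.sublist List.filter_sublist).sublist h2
      -- At most six old edges survive at an end of the new edge, which is the seventh.
      have hsub : ∀ d ∈ L, d ∈ (edgesAt D x).take 6 := by
        intro d hd
        have h4 := h2.subset hd
        rw [← List.take_append_drop 6 (edgesAt D x), List.mem_append] at h4
        exact h4.resolve_right (h3 d hd)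
      have := (hnd.subperm hsub).length_le
      have := List.length_take_le 6 (edgesAt D x)
      omega
    · push Not at hx
      exact (edgesAt_pushEdge_of_ne hx.1 hx.2).length_le.trans (hI.degree_le x)
  · intro x j
    change _ ≤ _ * φ' x
    by_cases hx : x = u ∨ x = v
    · obtain ⟨L, h1, h2, h3⟩ := edgesAt_pushEdge (D := D) hx
      rw [h1]
      have hLD : ∀ d ∈ L, d ∈ D := fun d hd => (mem_edgesAt.1 (h2.subset hd)).1
      obtain ⟨g1, g2⟩ := hstep x hx
      -- For `j = 0` the new edge contributes `H ≤ 5/2 * (φ' x - φ x)`. Otherwise it is among the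
      -- dropped edges and the index shifts by one, which the doubling of the potential compensates.
      cases j with
      | zero =>
        rw [List.drop_zero, List.map_cons, List.sum_cons, hmap L hLD, hh', Function.update_self]
        have h4 := sum_map_le_of_sublist hI.h_nonneg h2
        have h5 := htail x 0
        rw [List.drop_zero] at h5
        norm_num at h5 ⊢
        linarith
      | succ j =>
        rw [List.drop_succ_cons, hmap _ fun d hd => hLD d (List.mem_of_mem_drop hd)]
        refine (sum_map_le_of_sublist hI.h_nonneg (h2.drop j)).trans ((htail x j).trans ?_)
        have : (5 : ℝ) / 2 / 2 ^ j * φ x = 5 / 2 / 2 ^ (j + 1) * (2 * φ x) := by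
          rw [pow_succ]; field_simp
        rw [this]
        gcongr
    · push Not at hx
      have h1 := edgesAt_pushEdge_of_ne (D := D) hx.1 hx.2
      rw [hmap _ fun d hd => (mem_edgesAt.1 (h1.subset (List.mem_of_mem_drop hd))).1,
        ex' x hx.1 hx.2]
      exact (sum_map_le_of_sublist hI.h_nonneg (h1.drop j)).trans (htail x j)
  · rw [hpush]
    refine ⟨?_, ?_⟩
    · classical
      rw [hh', Function.update_self, Function.update_self, ← hh',
        hmap _ fun d hd => hFD.subset (List.mem_of_mem_filter hd)]
      have h1 : ((F.filter fun d => decide (EdgesTouch e d)).map h).sum ≤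
          ((edgesAt D u ++ edgesAt D v).map h).sum := by
        refine sum_map_le_of_forall_mem hI.h_nonneg
          ((hI.nodup.sublist hFD).sublist List.filter_sublist) fun d hd => ?_
        obtain ⟨hd1, hd2⟩ := List.mem_filter.1 hd
        obtain ⟨x, hx1, hx2⟩ := of_decide_eq_true hd2
        rw [List.mem_append, mem_edgesAt, mem_edgesAt]
        rcases Sym2.mem_iff.1 hx1 with rfl | rfl
        · exact .inl ⟨hFD.subset hd1, hx2⟩
        · exact .inr ⟨hFD.subset hd1, hx2⟩
      rw [List.map_append, List.sum_append] at h1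
      have h2 := htail u 0
      have h3 := htail v 0
      rw [List.drop_zero] at h2 h3
      norm_num at h2 h3
      -- The older edges touching `e` carry at most `5/2 * (φ u + φ v)`. Inserting `H`, what remains
      -- is `3/2 * (φ u + φ v) - (a u + a v) / 2 ≤ c / 2`, which follows from `φ ≤ a` and the
      -- threshold.
      convert_to H + ((F.filter fun d => decide (EdgesTouch e d)).map h).sum ≤ 5 / 2 * c
      linarith
    · exact (hI.charges.sublist hI.h_nonneg hFD).congr
        (fun d hd => Function.update_of_ne (hnD' d (hFD.subset hd)) _ _)
        (fun d hd => Function.update_of_ne (hnD' d (hFD.subset hd)) _ _)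
  · change _ * ∑ x, φ' x ≤ _
    rw [hpush, hsum, List.map_cons, List.sum_cons, hmap F fun d hd => hFD.subset hd, hh',
      Function.update_self]
    -- The discarded edges lie beyond the sixth at `u` or `v`. They carry at most `5/128 * (φ u + φ
    -- v) ≤ 5/256 * c ≤ 5/256 * H`, the share of the increase that `loss` gives away.
    have h1 : (D.map h).sum ≤
        ((F ++ ((edgesAt D u).drop 6 ++ (edgesAt D v).drop 6)).map h).sum := by
      refine sum_map_le_of_forall_mem hI.h_nonneg hI.nodup fun d hd => ?_
      rw [List.mem_append, List.mem_append, hF, List.mem_filter, decide_eq_true_eq]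
      tauto
    rw [List.map_append, List.map_append, List.sum_append, List.sum_append] at h1
    have h2 := htail u 6
    have h3 := htail v 6
    rw [show (5 : ℝ) / 2 / 2 ^ 6 = 5 / 128 by norm_num] at h2 h3
    have h4 := hI.loss
    rw [← hφ] at h4
    linarith
  · intro A hA
    rw [hpush, List.toFinset_cons] at hA
    have hFD' : F.toFinset ⊆ D.toFinset := fun d hd =>
      List.mem_toFinset.2 (hFD.subset (List.mem_toFinset.1 hd))
    have hcongr : ∀ B ⊆ D.toFinset, ∑ d ∈ B, Function.update w e c d = ∑ d ∈ B, w d :=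
      fun B hB => Finset.sum_congr rfl fun d hd =>
        Function.update_of_ne (hnD' d (List.mem_toFinset.1 (hB hd))) _ _
    by_cases heA : e ∈ A
    · have hB : A.erase e ⊆ D.toFinset := (Finset.subset_insert_iff.1 hA).trans hFD'
      rw [← Finset.add_sum_erase _ _ heA, hcongr _ hB, Function.update_self]
      have h1 := hI.weight_le _ hB
      have h2 := hf.marginal_le' hB (hDl.trans hlE) hE
      rw [Finset.insert_erase heA] at h2
      linarith
    · have hB : A ⊆ D.toFinset := ((Finset.subset_insert_iff_of_notMem heA).1 hA).trans hFD'
      rw [hcongr _ hB]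
      exact hI.weight_le _ hB
  · change _ ≤ ∑ x, φ' x
    have h1 := hf.marginal_le' hI.stored_subset hAE hE
    have h2 := hI.value_le
    rw [← hφ] at h2
    linarith
  · intro u' v' hm
    change _ ≤ 2 * (φ' u' + φ' v')
    rcases List.mem_append.1 hm with hm | hm
    · have h1 := hf.marginal_le' (Finset.subset_insert e Acc) (Finset.insert_subset hE hAE)
        (hlE (List.mem_toFinset.2 hm))
      have h2 := hI.marginal_le u' v' hm
      rw [← hφ] at h2
      linarith [hmono u', hmono v']
    · have hm := List.mem_singleton.1 hm
      rw [hm, Finset.insert_eq_of_mem (Finset.mem_insert_self _ _), sub_self]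
      linarith [hmono u', hmono v', hφ0 u', hφ0 v']
  · intro k hk u' v' hm
    change _ ≤ 2 * (φ' u' + φ' v')
    rcases List.mem_append.1 hm with hm | hm
    · have h2 := hI.singleton_le k hk u' v' hm
      rw [← hφ] at h2
      linarith [hmono u', hmono v']
    · have hm := List.mem_singleton.1 hm
      have h1 := hk D.toFinset (hDl.trans hlE) e (Finset.mem_sdiff.2 ⟨hE, hnD⟩)
      rw [Finset.union_comm, ← Finset.insert_eq] at h1
      rw [hm, hsym u' v' hm, eu', ev']
      linarith

theorem length_le (hI : MatchingInvariant E f l D Acc a b w h) :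
    D.length ≤ 7 * Fintype.card V := by
  have h1 : D.toFinset ⊆ Finset.univ.biUnion fun x => (edgesAt D x).toFinset := by
    intro d hd
    rw [Finset.mem_biUnion]
    refine ⟨d.out.1, Finset.mem_univ _, ?_⟩
    rw [List.mem_toFinset, mem_edgesAt]
    exact ⟨List.mem_toFinset.1 hd, Sym2.out_fst_mem d⟩
  rw [← List.toFinset_card_of_nodup hI.nodup]
  refine (Finset.card_le_card h1).trans (Finset.card_biUnion_le.trans ?_)
  calc ∑ x, (edgesAt D x).toFinset.card ≤ ∑ _x : V, 7 :=
        Finset.sum_le_sum fun x _ => (List.toFinset_card_le _).trans (hI.degree_le x)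
    _ = 7 * Fintype.card V := by simp [mul_comm]

/-- Weak duality: `2φ` is a fractional vertex cover for the weights `g`, and the edges of a matching
use disjoint pairs of vertices. -/
theorem sum_matching_le {φ : V → ℝ} (hφ : ∀ x, 0 ≤ φ x) {T : Finset (Sym2 V)}
    (hT : IsGraphMatching T) (hdiag : ∀ e ∈ T, ¬ e.IsDiag) {g : Sym2 V → ℝ}
    (hg : ∀ u v, s(u, v) ∈ T → g s(u, v) ≤ 2 * (φ u + φ v)) :
    ∑ e ∈ T, g e ≤ 2 * ∑ x, φ x := by
  have h1 : ∀ e ∈ T, g e ≤ 2 * ∑ x ∈ e.toFinset, φ x := by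
    intro e he
    induction e with
    | h u v =>
      have huv : u ≠ v := fun h => hdiag _ he (by simpa using h)
      rw [Sym2.toFinset_mk_eq, Finset.sum_pair huv]
      exact hg u v he
  refine (Finset.sum_le_sum h1).trans ?_
  rw [← Finset.mul_sum]
  refine mul_le_mul_of_nonneg_left ?_ (by norm_num)
  rw [← Finset.sum_biUnion]
  · exact Finset.sum_le_sum_of_subset_of_nonneg (Finset.subset_univ _) fun x _ _ => hφ x
  · intro e he e' he' hne
    rw [Function.onFun, Finset.disjoint_left]
    intro x hx hx'
    exact hT e he e' he' hne x (by simpa using hx) (by simpa using hx')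

/-- Let `Φ` be the total potential and `M` the greedy matching. Then `f T ≤ f Acc + 2Φ ≤ 3Φ` and `(1
- curvature) * f T ≤ 2Φ`, while `251/256 * Φ ≤ 5/2 * f M`. The constants obtained are `7.5 * 256/251
< 7.65` and `5 * 256/251 < 5.1`. -/
theorem isApproxMax (hf : IsMonoSubmodular l.toFinset f)
    (hI : MatchingInvariant l.toFinset f l D Acc a b w h) (hdiag : ∀ e ∈ l, ¬ e.IsDiag) :
    IsApproxMax l.toFinset IsGraphMatching f
      (curvatureRatio 7.75 5.585 (curvature l.toFinset f)) (greedyMatching D).toFinset := by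
  have hsub : (greedyMatching D).toFinset ⊆ D.toFinset := fun d hd =>
    List.mem_toFinset.2 ((greedyMatching_sublist D).subset (List.mem_toFinset.1 hd))
  have hφ0 : ∀ x, 0 ≤ vertexPotential a b x := fun x => by
    have := hI.b_nonneg x
    have := hI.b_le x
    simp only [vertexPotential]; linarith
  have h1 := sum_le_greedyMatching hI.h_nonneg hI.charges
  have h2 := hI.loss
  have h3 := hI.weight_le _ hsub
  rw [List.sum_toFinset _ (hI.nodup.sublist (greedyMatching_sublist D))] at h3
  have h0 : 0 ≤ ∑ x, vertexPotential a b x := Finset.sum_nonneg fun x _ => hφ0 x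
  refine isApproxMax_of_bounds (by norm_num) (by norm_num)
    ((hsub.trans hI.stored_subset).trans hI.acc_subset) (isGraphMatching_greedyMatching D) ?_ ?_
  · intro T hT hTM
    have h4 := hf.le_add_sum hI.acc_subset hT
    have h5 := sum_matching_le hφ0 hTM (fun e he => hdiag e (List.mem_toFinset.1 (hT he)))
      (g := fun o => f (insert o Acc) - f Acc)
      fun u v huv => hI.marginal_le u v (List.mem_toFinset.1 (hT huv))
    have h6 := hI.value_le
    norm_num at h2 ⊢
    linarith
  · intro T hT hTM
    have hc := hf.curvatureBound_curvature
    have h4 := hf.one_sub_curvature_mul_le hT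
    have h5 := sum_matching_le hφ0 hTM (fun e he => hdiag e (List.mem_toFinset.1 (hT he)))
      (g := fun o => (1 - curvature l.toFinset f) * f {o})
      fun u v huv => hI.singleton_le _ hc u v (List.mem_toFinset.1 (hT huv))
    norm_num at h2 ⊢
    linarith

end MatchingInvariant

end MatchingPotential

/-! ### Registers -/

/-- The least natural number that is not in `T`. -/
noncomputable def freshNat (T : Finset ℕ) : ℕ := sInf {k | k ∉ T}

theorem freshNat_notMem (T : Finset ℕ) : freshNat T ∉ T :=
  Nat.sInf_mem (s := {k | k ∉ T}) (Infinite.exists_notMem_finset T)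

theorem freshNat_le (T : Finset ℕ) : freshNat T ≤ T.card := by
  obtain ⟨k, hk, hkT⟩ : ∃ k ∈ Finset.range (T.card + 1), k ∉ T :=
    Finset.exists_mem_notMem_of_card_lt_card (by simp)
  exact (Nat.sInf_le (s := {k | k ∉ T}) hkT).trans (Nat.lt_succ_iff.1 (Finset.mem_range.1 hk))

/-- The weight kept in slot `c`: the difference of the registers `2 * c + 1` and `2 * c`. -/
def slotValue (reg : ℕ → ℝ) (c : ℕ) : ℝ := reg (2 * c + 1) - reg (2 * c)

/-- The linear form that computes `slotValue`. -/
noncomputable def slotForm (c : ℕ) : ℕ →₀ ℝ :=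
  Finsupp.single (2 * c + 1) 1 - Finsupp.single (2 * c) 1

theorem linearCombination_slotForm (reg : ℕ → ℝ) (c : ℕ) :
    Finsupp.linearCombination ℝ reg (slotForm c) = slotValue reg c := by
  simp [slotForm, slotValue]

theorem slotValue_update (reg : ℕ → ℝ) (k c : ℕ) (y z : ℝ) :
    slotValue (Function.update (Function.update reg (2 * k + 1) y) (2 * k) z) c =
      if c = k then y - z else slotValue reg c := by
  unfold slotValue
  split_ifs with h
  · subst h
    rw [Function.update_of_ne (by omega), Function.update_self, Function.update_self]
  · rw [Function.update_of_ne (by omega), Function.update_of_ne (by omega),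
      Function.update_of_ne (by omega), Function.update_of_ne (by omega)]

namespace QueryTree

variable {X : Type} [DecidableEq X] {p : ℕ} {α : Type}

/-- Write the marginal value of `x` with respect to `S` into slot `c`. -/
def evalMarginal (S : Finset X) (x : X) (c : ℕ) (k : QueryTree X p α) : QueryTree X p α :=
  .eval (insert x S) (2 * c + 1) (.eval S (2 * c) k)

theorem Meets.evalMarginal {O : StreamOracles X p} {store : Finset X} {R : ℕ}
    {Q : α → (ℕ → ℝ) → Prop} {d q : ℕ} {reg : ℕ → ℝ} {S : Finset X} {x : X} {c : ℕ}
    {k : QueryTree X p α} (hS : insert x S ⊆ store) (hR : 2 * c + 1 < R)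
    (h : ∀ reg', (∀ c', slotValue reg' c' =
      if c' = c then O.value (insert x S) - O.value S else slotValue reg c') →
      k.Meets O store R Q d q reg') :
    (evalMarginal S x c k).Meets O store R Q (d + 2) (q + 2) reg :=
  .eval hS hR (.eval ((Finset.subset_insert x S).trans hS) (by omega)
    (h _ fun c' => slotValue_update reg c c' _ _))

omit [DecidableEq X] in
theorem Meets.test_form {O : StreamOracles X p} {store : Finset X} {R : ℕ}
    {Q : α → (ℕ → ℝ) → Prop} {d q : ℕ} {reg : ℕ → ℝ} {w : ℕ →₀ ℝ} {y n : QueryTree X p α}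
    (hy : 0 ≤ Finsupp.linearCombination ℝ reg w → y.Meets O store R Q d q reg)
    (hn : Finsupp.linearCombination ℝ reg w < 0 → n.Meets O store R Q d q reg) :
    (QueryTree.test w y n).Meets O store R Q (d + 1) q reg := by
  refine .test ?_
  split_ifs with h
  · exact hy h
  · exact hn (not_le.1 h)

end QueryTree

theorem StreamAlg.RunsWithin.mono {X : Type} [DecidableEq X] {p : ℕ} {A : StreamAlg X p}
    {O : StreamOracles X p} {σ : List X} {s b q s' b' q' : ℕ} (h : A.RunsWithin O σ s b q)
    (hs : s ≤ s') (hb : b ≤ b') (hq : q ≤ q') : A.RunsWithin O σ s' b' q' := fun c hc =>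
  let ⟨h1, h2, h3, h4⟩ := h c hc
  ⟨h1.trans hs, h2.trans hs, h3.trans hb, h4.trans hq⟩

/-! ### Streaming matchings: the program -/

section MatchingProgram

variable {n : ℕ}

/-- The bit string for an edge. -/
noncomputable def encEdge (e : Sym2 (Fin n)) : List Bool :=
  bitPair (Nat.bits (Quot.out e).1) (Nat.bits (Quot.out e).2)

theorem encEdge_injective : Function.Injective (encEdge (n := n)) := by
  intro e e' h
  obtain ⟨h1, h2⟩ := bitPair_inj h
  have : Quot.out e = Quot.out e' :=
    Prod.ext (Fin.ext (bits_injective h1)) (Fin.ext (bits_injective h2))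
  rw [← Quot.out_eq e, this, Quot.out_eq]

theorem length_encEdge_le (e : Sym2 (Fin n)) :
    (encEdge e).length ≤ 3 * (Nat.log 2 n + 1) + 1 := by
  have h1 := length_bits_le (Quot.out e).1.2.le
  have h2 := length_bits_le (Quot.out e).2.2.le
  rw [encEdge, length_bitPair]
  omega

/-- The state of the matching program: the stored edges, and for each vertex the slots of its
two weights. -/
abbrev MatchingState (n : ℕ) : Type := List (Sym2 (Fin n)) × (Fin n → ℕ) × (Fin n → ℕ)

/-- The bit string for a state. -/
noncomputable def encMatchingState (s : MatchingState n) : List Bool :=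
  bitPair (bitList encEdge s.1)
    (bitPair (bitList Nat.bits (List.ofFn s.2.1)) (bitList Nat.bits (List.ofFn s.2.2)))

theorem encMatchingState_injective : Function.Injective (encMatchingState (n := n)) := by
  intro s s' h
  obtain ⟨h1, h2⟩ := bitPair_inj h
  obtain ⟨h3, h4⟩ := bitPair_inj h2
  exact Prod.ext (bitList_injective encEdge_injective h1)
    (Prod.ext (List.ofFn_injective (bitList_injective bits_injective h3))
      (List.ofFn_injective (bitList_injective bits_injective h4)))

/-- The slots in use. -/
def usedSlots (s : MatchingState n) : Finset ℕ :=
  Finset.univ.image s.2.1 ∪ Finset.univ.image s.2.2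

/-- The linear form that computes the potential of a vertex. -/
noncomputable def potentialForm (s : MatchingState n) (x : Fin n) : ℕ →₀ ℝ :=
  slotForm (s.2.1 x) - (1 / 2 : ℝ) • slotForm (s.2.2 x)

/-- The streaming matching program. -/
noncomputable def matchingProgram (n : ℕ) : StreamProgram (Sym2 (Fin n)) 0 where
  State := MatchingState n
  enc := encMatchingState
  enc_injective := encMatchingState_injective
  start := ([], fun _ => 0, fun _ => 0)
  keep s := s.1.toFinset
  item s e :=
    let u := (Quot.out e).1
    let v := (Quot.out e).2
    let k := freshNat (usedSlots s)
    .evalMarginal s.1.toFinset e k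
      (.test (slotForm k - (2 : ℝ) • (potentialForm s u + potentialForm s v))
        (.pure (pushEdge s.1 u v, setPair s.2.1 u v k k, setPair s.2.2 u v (s.2.1 v) (s.2.1 u)))
        (.pure s))
  final s := .pure (greedyMatching s.1).toFinset

/-- The invariant of the program: the slots in use hold the weights of the vertices. -/
def MatchingProgramInvariant (E : Finset (Sym2 (Fin n))) (f : Finset (Sym2 (Fin n)) → ℝ)
    (l : List (Sym2 (Fin n))) (s : MatchingState n) (reg : ℕ → ℝ) : Prop :=
  (∀ x, s.2.1 x ≤ 2 * n ∧ s.2.2 x ≤ 2 * n) ∧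
    ∃ Acc w h, MatchingInvariant E f l s.1 Acc (fun x => slotValue reg (s.2.1 x))
      (fun x => slotValue reg (s.2.2 x)) w h

theorem card_usedSlots_le (s : MatchingState n) : (usedSlots s).card ≤ 2 * n := by
  have h1 : (Finset.univ.image s.2.1).card ≤ n := by
    simpa using Finset.card_image_le (s := Finset.univ) (f := s.2.1)
  have h2 : (Finset.univ.image s.2.2).card ≤ n := by
    simpa using Finset.card_image_le (s := Finset.univ) (f := s.2.2)
  have := Finset.card_union_le (Finset.univ.image s.2.1) (Finset.univ.image s.2.2)
  unfold usedSlots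
  omega

theorem length_encMatchingState_le {E : Finset (Sym2 (Fin n))} {f : Finset (Sym2 (Fin n)) → ℝ}
    {l : List (Sym2 (Fin n))} {s : MatchingState n} {reg : ℕ → ℝ} (hn : n ≠ 0)
    (hI : MatchingProgramInvariant E f l s reg) :
    (encMatchingState s).length ≤ 150 * n * (Nat.log 2 n + 1) := by
  obtain ⟨hs, Acc, w, h, hI⟩ := hI
  have h1 := hI.length_le
  rw [Fintype.card_fin] at h1
  set B := Nat.log 2 n + 1 with hB
  have h2 : (bitList encEdge s.1).length ≤ s.1.length * (2 * (3 * B + 1) + 1) :=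
    length_bitList_le fun e _ => length_encEdge_le e
  have hlog : Nat.log 2 (2 * n) = B := by
    rw [mul_comm, Nat.log_mul_base (by norm_num) hn]
  have h3 : (bitList Nat.bits (List.ofFn s.2.1)).length ≤ n * (2 * (B + 1) + 1) := by
    refine (length_bitList_le (b := B + 1) fun k hk => ?_).trans (by simp)
    obtain ⟨x, rfl⟩ := (List.mem_ofFn' _ _).1 hk
    exact (length_bits_le (hs x).1).trans (by rw [hlog])
  have h4 : (bitList Nat.bits (List.ofFn s.2.2)).length ≤ n * (2 * (B + 1) + 1) := by
    refine (length_bitList_le (b := B + 1) fun k hk => ?_).trans (by simp)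
    obtain ⟨x, rfl⟩ := (List.mem_ofFn' _ _).1 hk
    exact (length_bits_le (hs x).2).trans (by rw [hlog])
  have h5 : s.1.length * (2 * (3 * B + 1) + 1) ≤ 7 * n * (2 * (3 * B + 1) + 1) :=
    Nat.mul_le_mul_right _ h1
  rw [encMatchingState, length_bitPair, length_bitPair]
  -- The length is at most `90 * n * B + 51 * n + 2`, and both `n` and `1` are at most `n * B`.
  have h6 : n ≤ n * B := Nat.le_mul_of_pos_right _ (by omega)
  have h7 : 1 ≤ n * B := Nat.mul_pos (by omega) (by omega)
  nlinarith

/-- The marginal value goes to a slot that no vertex uses, so all stored weights survive. Register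
contents cannot be copied; on acceptance only the names of slots are passed on between vertices. -/
theorem matchingProgram_item {σ : List (Sym2 (Fin n))} (hσ : σ.Nodup)
    (hdiag : ∀ e ∈ σ, ¬ e.IsDiag) {f : Finset (Sym2 (Fin n)) → ℝ}
    (hf : IsMonoSubmodular σ.toFinset f) {l r : List (Sym2 (Fin n))} {e : Sym2 (Fin n)}
    (hl : σ = l ++ e :: r) {s : MatchingState n} {reg : ℕ → ℝ}
    (hI : MatchingProgramInvariant σ.toFinset f l s reg)
    {O : StreamOracles (Sym2 (Fin n)) 0} (hO : O.value = f) :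
    ((matchingProgram n).item s e).Meets O (insert e s.1.toFinset) (9 * n)
      (fun s' reg' => s'.1.toFinset ⊆ insert e s.1.toFinset ∧
        MatchingProgramInvariant σ.toFinset f (l ++ [e]) s' reg') 3 2 reg := by
  obtain ⟨hs, Acc, w, h, hI⟩ := hI
  obtain ⟨u, v, huv⟩ : ∃ u v, Quot.out e = (u, v) := ⟨_, _, rfl⟩
  have he : e = s(u, v) := by rw [← Quot.out_eq e, huv]
  have hne : u ≠ v := fun h => hdiag e (by simp [hl]) (by simp [he, h])
  have hsub : (l ++ [e]).toFinset ⊆ σ.toFinset := by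
    intro x hx
    rw [hl]
    simp only [List.mem_toFinset, List.mem_append, List.mem_cons] at hx ⊢
    tauto
  have hnew : e ∉ l := by
    rw [hl] at hσ
    exact fun h => List.disjoint_of_nodup_append hσ h (by simp)
  have hk1 := freshNat_notMem (usedSlots s)
  have hk2 := (freshNat_le (usedSlots s)).trans (card_usedSlots_le s)
  simp only [matchingProgram, huv]
  set k := freshNat (usedSlots s) with hk
  have hcur : ∀ x, s.2.1 x ≠ k := fun x h => hk1 (by
    rw [← h]; exact Finset.mem_union_left _ (Finset.mem_image_of_mem _ (Finset.mem_univ x)))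
  have hold : ∀ x, s.2.2 x ≠ k := fun x h => hk1 (by
    rw [← h]; exact Finset.mem_union_right _ (Finset.mem_image_of_mem _ (Finset.mem_univ x)))
  refine .evalMarginal subset_rfl (by omega) fun reg' hreg => ?_
  rw [hO] at hreg
  have hk' : slotValue reg' k = f (insert e s.1.toFinset) - f s.1.toFinset := by
    rw [hreg, if_pos rfl]
  have hcur' : ∀ x, slotValue reg' (s.2.1 x) = slotValue reg (s.2.1 x) := fun x => by
    rw [hreg, if_neg (hcur x)]
  have hold' : ∀ x, slotValue reg' (s.2.2 x) = slotValue reg (s.2.2 x) := fun x => by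
    rw [hreg, if_neg (hold x)]
  have hpot : ∀ x, Finsupp.linearCombination ℝ reg' (potentialForm s x) =
      vertexPotential (fun x => slotValue reg (s.2.1 x)) (fun x => slotValue reg (s.2.2 x)) x := by
    intro x
    simp only [potentialForm, map_sub, map_smul, linearCombination_slotForm, hcur', hold',
      vertexPotential, smul_eq_mul]
    ring
  refine .test_form (fun ht => .pure ⟨?_, ?_, ?_⟩) (fun ht => .pure ⟨?_, ?_, ?_⟩)
  · intro d hd
    simp only [pushEdge, ← he, List.toFinset_cons, Finset.mem_insert, List.mem_toFinset,
      List.mem_filter] at hd ⊢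
    tauto
  · intro x
    simp only [setPair]
    split_ifs <;> refine ⟨?_, ?_⟩ <;> first | exact hk2 | exact (hs _).1 | exact (hs _).2
  · simp only [map_sub, map_smul, map_add, hpot, linearCombination_slotForm, smul_eq_mul,
      hk'] at ht
    rw [he] at hsub hnew hk' ⊢
    have := hI.accept hf hne hsub hnew hk' (by rw [hk', ← he]; linarith)
    have e1 : setPair (fun x => slotValue reg (s.2.1 x)) u v (slotValue reg' k)
        (slotValue reg' k) = fun x => slotValue reg' (setPair s.2.1 u v k k x) := by
      funext x
      simp only [setPair]
      split_ifs <;> simp [hcur']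
    have e2 : setPair (fun x => slotValue reg (s.2.2 x)) u v (slotValue reg (s.2.1 v))
        (slotValue reg (s.2.1 u)) =
          fun x => slotValue reg' (setPair s.2.2 u v (s.2.1 v) (s.2.1 u) x) := by
      funext x
      simp only [setPair]
      split_ifs <;> simp [hcur', hold']
    rw [e1, e2] at this
    exact ⟨_, _, _, this⟩
  · exact Finset.subset_insert _ _
  · exact hs
  · simp only [map_sub, map_smul, map_add, hpot, linearCombination_slotForm, smul_eq_mul,
      hk'] at ht
    simp only [hcur', hold']
    rw [he] at hsub hnew ht ⊢
    exact ⟨_, _, _, hI.reject hf hsub hnew (by linarith)⟩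

theorem exists_matching_alg (n : ℕ) : ∃ A : StreamAlg (Sym2 (Fin n)) 0,
    ∀ σ : List (Sym2 (Fin n)), σ.Nodup → (∀ e ∈ σ, ¬ e.IsDiag) →
    ∀ f : Finset (Sym2 (Fin n)) → ℝ, IsMonoSubmodular σ.toFinset f →
      A.RunsWithin ⟨f, fun i => i.elim0⟩ σ
        (400 * n) (400 * n * (Nat.log 2 n + 1)) (400 * (σ.length + 1)) ∧
      ∃ M, A.Outputs ⟨f, fun i => i.elim0⟩ σ M ∧
        IsApproxMax σ.toFinset IsGraphMatching f
          (curvatureRatio 7.75 5.585 (curvature σ.toFinset f)) M := by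
  -- For `n = 0` the bounds allow no memory at all, so a machine with a single state, coded by the
  -- empty string, outputs `∅` at once.
  rcases Nat.eq_zero_or_pos n with rfl | hn
  · let A : StreamAlg (Sym2 (Fin 0)) 0 :=
      { Mem := Unit, enc := fun _ => [], enc_injective := fun _ _ _ => rfl, start := (),
        act := fun _ _ => .output ∅ }
    refine ⟨A, fun σ hσ hdiag f hf => ⟨fun c hc => ?_, ∅, ⟨_, .refl, ?_⟩, ?_⟩⟩
    · induction hc with
      | refl => simp [StreamAlg.initial, A]
      | tail _ h _ => simp [StreamAlg.step, A] at h
    · simp [StreamAlg.step, A]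
    · have hl : σ = [] := List.eq_nil_iff_forall_not_mem.2 fun e _ => (Quot.out e).1.elim0
      subst hl
      have := (MatchingInvariant.nil hf).isApproxMax hf (by simp)
      rwa [greedyMatching] at this
  · refine ⟨(matchingProgram n).toAlg encEdge encEdge_injective, fun σ hσ hdiag f hf => ?_⟩
    have hlog : 1 ≤ Nat.log 2 n + 1 := by omega
    have h7 : 1 ≤ n * (Nat.log 2 n + 1) := Nat.mul_pos hn hlog
    have h8 : Nat.log 2 n + 1 ≤ n * (Nat.log 2 n + 1) := Nat.le_mul_of_pos_left _ hn
    obtain ⟨h1, M, h2, h3⟩ := (matchingProgram n).toAlg_correct encEdge_injective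
      (O := ⟨f, fun i => i.elim0⟩) (σ := σ)
      (Inv := fun l s reg => MatchingProgramInvariant σ.toFinset f l s reg)
      (P := IsApproxMax σ.toFinset IsGraphMatching f
          (curvatureRatio 7.75 5.585 (curvature σ.toFinset f)))
      (sz := 9 * n) (bS := 150 * n * (Nat.log 2 n + 1)) (bX := 3 * (Nat.log 2 n + 1) + 1)
      (d := 3) (q := 2) rfl
      ⟨fun x => by simp [matchingProgram], ∅, _, _, by
        simpa [slotValue, matchingProgram] using MatchingInvariant.nil hf⟩
      (fun l x r hl s reg hI => matchingProgram_item hσ hdiag hf hl hI rfl)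
      (fun s reg hI => by
        obtain ⟨hs, Acc, w, h, hI⟩ := hI
        refine .pure ⟨fun d hd => ?_, hI.isApproxMax hf hdiag⟩
        exact List.mem_toFinset.2 ((greedyMatching_sublist _).subset (List.mem_toFinset.1 hd)))
      (fun l s reg hI => by
        refine ⟨?_, length_encMatchingState_le hn.ne' hI⟩
        obtain ⟨hs, Acc, w, h, hI⟩ := hI
        have h1 := hI.length_le
        have h2 := List.toFinset_card_le s.1
        rw [Fintype.card_fin] at h1
        change s.1.toFinset.card + 1 ≤ _
        omega)
      (fun e _ => length_encEdge_le e)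
    refine ⟨h1.mono (by omega) ?_ (by omega), M, h2, h3⟩
    nlinarith

end MatchingProgram

/-! ### Exchange systems -/

open scoped ENNReal

/-- Constraints `ind i`, each with a closure and a rank that control the independent sets among
the elements that are subject to the constraint (those `x` with `i ∈ idx x`). -/
structure ExchangeSystem (X ι : Type) [DecidableEq X] where
  idx : X → Finset ι
  ind : ι → Finset X → Prop
  cl : ι → Finset X → X → Prop
  rk : ι → Finset X → ℝ≥0∞
  ind_empty : ∀ i, ind i ∅
  ind_mono : ∀ i A B, A ⊆ B → ind i B → ind i A
  ind_insert_of_notMem : ∀ i A x, i ∉ idx x → ind i A → ind i (insert x A)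
  cl_mono : ∀ i A B x, A ⊆ B → cl i A x → cl i B x
  cl_of_mem : ∀ i A x, x ∈ A → i ∈ idx x → cl i A x
  rk_empty : ∀ i, rk i ∅ = 0
  rk_insert_le : ∀ i A x, rk i (insert x A) ≤ rk i A + 1
  rk_insert_of_notMem : ∀ i A x, i ∉ idx x → rk i (insert x A) ≤ rk i A
  rk_insert_of_cl : ∀ i A x, cl i A x → rk i (insert x A) ≤ rk i A
  card_le : ∀ i A T, ind i T → (∀ o ∈ T, i ∈ idx o ∧ cl i A o) → (T.card : ℝ≥0∞) ≤ rk i A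

namespace ExchangeSystem

/-! ### Weighted rank as an integral over superlevel sets -/

open MeasureTheory Set

variable {X ι : Type} [DecidableEq X] (M : ExchangeSystem X ι)

/-- The rank integrated over the superlevel sets of the weight `w` on `A`. -/
noncomputable def levelRank (i : ι) (A : Finset X) (w : X → ℝ) : ℝ≥0∞ :=
  ∫⁻ θ in Ioi (0 : ℝ), M.rk i (A.filter fun a => θ ≤ w a)

theorem levelRank_congr (i : ι) {A : Finset X} {w w' : X → ℝ} (h : ∀ a ∈ A, w' a = w a) :
    M.levelRank i A w' = M.levelRank i A w := by
  unfold levelRank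
  congr 1
  funext θ
  rw [Finset.filter_congr fun a ha => by rw [h a ha]]

theorem levelRank_empty (i : ι) (w : X → ℝ) : M.levelRank i ∅ w = 0 := by
  simp [levelRank, M.rk_empty]

theorem levelRank_insert_of_notMem {i : ι} {A : Finset X} {x : X} (w : X → ℝ)
    (hi : i ∉ M.idx x) : M.levelRank i (insert x A) w ≤ M.levelRank i A w := by
  refine lintegral_mono fun θ => ?_
  simp only [Finset.filter_insert]
  split_ifs
  · exact M.rk_insert_of_notMem i _ x hi
  · exact le_rfl

/-- Level sets above `w x` do not change, and at levels up to `u` the new element is already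
spanned. The rank thus grows only on `(u, w x]`, and there by at most one. -/
theorem levelRank_insert_le {i : ι} {A : Finset X} {x : X} {w : X → ℝ} {u : ℝ}
    (hcl : 0 < u → M.cl i (A.filter fun a => u ≤ w a) x) :
    M.levelRank i (insert x A) w ≤ M.levelRank i A w + ENNReal.ofReal (w x - u) := by
  have h1 : ∀ θ ∈ Ioi (0 : ℝ), M.rk i ((insert x A).filter fun a => θ ≤ w a) ≤
      M.rk i (A.filter fun a => θ ≤ w a) + (Ioc u (w x)).indicator 1 θ := by
    intro θ hθ
    rw [Finset.filter_insert]
    split_ifs with hx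
    · by_cases hu : u < θ
      · rw [indicator_of_mem (show θ ∈ Ioc u (w x) from ⟨hu, hx⟩)]
        exact M.rk_insert_le i _ x
      · have hu := not_lt.1 hu
        refine (M.rk_insert_of_cl i _ x (M.cl_mono i _ _ x ?_ (hcl (lt_of_lt_of_le hθ hu)))).trans
          le_self_add
        exact fun a ha => by
          rw [Finset.mem_filter] at ha ⊢
          exact ⟨ha.1, hu.trans ha.2⟩
    · exact le_self_add
  refine (setLIntegral_mono' measurableSet_Ioi h1).trans ?_
  rw [lintegral_add_right _ (measurable_one.indicator measurableSet_Ioc)]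
  refine add_le_add le_rfl ((lintegral_indicator_one_le _).trans ?_)
  exact (Measure.restrict_le_self _).trans (by rw [Real.volume_Ioc])

/-- Layer-cake argument: at level `θ` the elements of `T` with `u o ≥ θ` are independent and spanned
by the level set of `w`, so the rank of the latter bounds their number. -/
theorem sum_le_levelRank {i : ι} {A T : Finset X} {w u : X → ℝ} (hT : M.ind i T)
    (hidx : ∀ o ∈ T, i ∈ M.idx o)
    (hcl : ∀ o ∈ T, 0 < u o → M.cl i (A.filter fun a => u o ≤ w a) o) :
    ∑ o ∈ T, ENNReal.ofReal (u o) ≤ M.levelRank i A w := by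
  have h1 : ∀ o, ENNReal.ofReal (u o) = ∫⁻ θ in Ioi (0 : ℝ), (Iic (u o)).indicator 1 θ := by
    intro o
    rw [lintegral_indicator_one measurableSet_Iic, Measure.restrict_apply measurableSet_Iic,
      inter_comm, Ioi_inter_Iic, Real.volume_Ioc, sub_zero]
  simp only [h1]
  rw [← lintegral_finsetSum _ fun o _ => measurable_one.indicator measurableSet_Iic]
  refine setLIntegral_mono' measurableSet_Ioi fun θ hθ => ?_
  have h2 : ∑ o ∈ T, (Iic (u o)).indicator (1 : ℝ → ℝ≥0∞) θ =
      ((T.filter fun o => θ ≤ u o).card : ℝ≥0∞) := by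
    rw [Finset.card_filter, Nat.cast_sum]
    refine Finset.sum_congr rfl fun o _ => ?_
    by_cases h : θ ≤ u o <;> simp [indicator, h]
  rw [h2]
  refine M.card_le i _ _ (M.ind_mono i _ _ (Finset.filter_subset _ _) hT) fun o ho => ?_
  rw [Finset.mem_filter] at ho
  refine ⟨hidx o ho.1, M.cl_mono i _ _ o ?_ (hcl o ho.1 (lt_of_lt_of_le hθ ho.2))⟩
  exact fun a ha => by
    rw [Finset.mem_filter] at ha ⊢
    exact ⟨ha.1, ho.2.trans ha.2⟩

end ExchangeSystem

/-- The invariant of the exchange algorithm on the processed part `l` of the stream: `S` is the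
current solution, `K` the set of elements that were accepted and exchanged later, and `w x` the
weight of `x` on arrival. -/
structure ExchangeInvariant {X ι : Type} [DecidableEq X] [Fintype ι] (M : ExchangeSystem X ι)
    (p : ℕ) (g : ℝ) (E : Finset X) (f : Finset X → ℝ) (l : List X) (S K : Finset X)
    (w : X → ℝ) : Prop where
  subset : S ∪ K ⊆ l.toFinset
  disjoint : Disjoint S K
  ind : ∀ i, M.ind i S
  nonneg : ∀ x, 0 ≤ w x
  gain : g * ∑ x ∈ K, w x ≤ ∑ x ∈ S, w x
  weight_le : ∀ A ⊆ S, ∑ x ∈ A, w x ≤ f A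
  value_le : f (S ∪ K) ≤ ∑ x ∈ S, w x + ∑ x ∈ K, w x
  marginal_le : ∀ o ∈ l, f (insert o (S ∪ K)) - f (S ∪ K) ≤ w o
  singleton_le : ∀ c, CurvatureBound E f c → ∀ o ∈ l, (1 - c) * f {o} ≤ w o
  cover : ∀ o ∈ l, (∀ i, M.ind i {o}) → ∃ u : ι → ℝ, (∀ i, 0 ≤ u i) ∧
    w o ≤ (1 + g) * ∑ i ∈ M.idx o, u i ∧
    ∀ i ∈ M.idx o, 0 < u i → M.cl i ((S ∪ K).filter fun a => u i ≤ w a) o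
  levelRank_le : ∑ i, M.levelRank i (S ∪ K) w ≤
    ENNReal.ofReal (p * ∑ x ∈ S, w x + (p - 1) * ∑ x ∈ K, w x)

/-! ### Preservation of the exchange invariant and the two estimates -/

namespace ExchangeInvariant

variable {X ι : Type} [DecidableEq X] [Fintype ι] {M : ExchangeSystem X ι}
  {p : ℕ} {g : ℝ} {E : Finset X} {f : Finset X → ℝ} {l : List X} {S K : Finset X} {w : X → ℝ}

theorem nil (hf : IsMonoSubmodular E f) : ExchangeInvariant M p g E f [] ∅ ∅ fun _ => 0 where
  subset := by simp
  disjoint := by simp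
  ind := M.ind_empty
  nonneg := by simp
  gain := by simp
  weight_le := by
    intro A hA
    rw [Finset.subset_empty] at hA
    simp [hA, hf.proper]
  value_le := by simp [hf.proper]
  marginal_le := by simp
  singleton_le := by simp
  cover := by simp
  levelRank_le := by simp [M.levelRank_empty]

/-- The weight of a rejected element is recorded too, since `cover` has to bound it. Nothing is
required if `x` alone violates a constraint, as no competitor then contains it. -/
theorem reject (hf : IsMonoSubmodular E f) (hI : ExchangeInvariant M p g E f l S K w) {x : X}
    (hl : (l ++ [x]).toFinset ⊆ E) (hx : x ∉ l) {c : ℝ} (hc : c = f (insert x S) - f S)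
    (hrej : (∀ i, M.ind i {x}) → ∃ u : ι → ℝ, (∀ i, 0 ≤ u i) ∧
      c ≤ (1 + g) * ∑ i ∈ M.idx x, u i ∧
      ∀ i ∈ M.idx x, 0 < u i → M.cl i (S.filter fun a => u i ≤ w a) x) :
    ExchangeInvariant M p g E f (l ++ [x]) S K (Function.update w x c) := by
  have hlE : l.toFinset ⊆ E := fun y hy => hl (by simp_all)
  have hE : x ∈ E := hl (by simp)
  have hSl : S ⊆ l.toFinset := Finset.subset_union_left.trans hI.subset
  have hne : ∀ a ∈ l, Function.update w x c a = w a := fun a ha =>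
    Function.update_of_ne (fun h => hx (by rwa [h] at ha)) _ _
  have hneA : ∀ a ∈ S ∪ K, Function.update w x c a = w a := fun a ha =>
    hne a (List.mem_toFinset.1 (hI.subset ha))
  have hS : ∀ A ⊆ S ∪ K, ∑ a ∈ A, Function.update w x c a = ∑ a ∈ A, w a := fun A hA =>
    Finset.sum_congr rfl fun a ha => hneA a (hA ha)
  have hS1 := hS S Finset.subset_union_left
  have hS2 := hS K Finset.subset_union_right
  refine ⟨?_, hI.disjoint, hI.ind, ?_, ?_, ?_, ?_, ?_, ?_, ?_, ?_⟩
  · exact hI.subset.trans fun y hy => by simp_all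
  · intro y
    by_cases hy : y = x
    · rw [hy, Function.update_self, hc]
      exact hf.marginal_nonneg (hSl.trans hlE) hE
    · rw [Function.update_of_ne hy]
      exact hI.nonneg y
  · rw [hS1, hS2]
    exact hI.gain
  · intro A hA
    rw [hS A (hA.trans Finset.subset_union_left)]
    exact hI.weight_le A hA
  · rw [hS1, hS2]
    exact hI.value_le
  · intro o ho
    rcases List.mem_append.1 ho with ho | ho
    · rw [hne o ho]
      exact hI.marginal_le o ho
    · rw [List.mem_singleton.1 ho, Function.update_self, hc]
      exact hf.marginal_le' Finset.subset_union_left (hI.subset.trans hlE) hE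
  · intro k hk o ho
    rcases List.mem_append.1 ho with ho | ho
    · rw [hne o ho]
      exact hI.singleton_le k hk o ho
    · rw [List.mem_singleton.1 ho, Function.update_self, hc]
      have := hk S (hSl.trans hlE) x
        (Finset.mem_sdiff.2 ⟨hE, fun h => hx (List.mem_toFinset.1 (hSl h))⟩)
      rwa [Finset.union_comm, ← Finset.insert_eq] at this
  · have hfil : ∀ t : ℝ, ((S ∪ K).filter fun a => t ≤ Function.update w x c a) =
        (S ∪ K).filter fun a => t ≤ w a := fun t =>
      Finset.filter_congr fun a ha => by rw [hneA a ha]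
    intro o ho hind
    simp only [hfil]
    rcases List.mem_append.1 ho with ho | ho
    · rw [hne o ho]
      exact hI.cover o ho hind
    · have ho := List.mem_singleton.1 ho
      subst ho
      rw [Function.update_self]
      obtain ⟨u, h1, h2, h3⟩ := hrej hind
      exact ⟨u, h1, h2, fun i hi hu => M.cl_mono i _ _ o
        (Finset.filter_subset_filter _ Finset.subset_union_left) (h3 i hi hu)⟩
  · rw [hS1, hS2]
    exact (Finset.sum_congr rfl fun i _ => M.levelRank_congr i hneA).trans_le hI.levelRank_le

/-- Let `U` be the sum of the thresholds `u i`. The ranks grow by at most `p * c - U` in total. The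
bound in `levelRank_le` grows by `p * (c - w C) + (p - 1) * w C = p * c - w C`, which is no less
since `w C ≤ U`. -/
theorem accept (hf : IsMonoSubmodular E f) (hp : 1 ≤ p) (hg : 0 ≤ g)
    (hI : ExchangeInvariant M p g E f l S K w) {x : X}
    (hl : (l ++ [x]).toFinset ⊆ E) (hx : x ∉ l) {c : ℝ} (hc : c = f (insert x S) - f S)
    (hidx : (M.idx x).card ≤ p) (hidx' : (M.idx x).Nonempty) {C : Finset X} (hCS : C ⊆ S)
    {u : ι → ℝ} (hu : ∀ i, 0 ≤ u i)
    (hcl : ∀ i ∈ M.idx x, 0 < u i → M.cl i (S.filter fun a => u i ≤ w a) x)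
    (hC : ∑ a ∈ C, w a ≤ ∑ i ∈ M.idx x, u i) (hacc : (1 + g) * ∑ i ∈ M.idx x, u i ≤ c)
    (hind : ∀ i, M.ind i (insert x (S \ C))) :
    ExchangeInvariant M p g E f (l ++ [x]) (insert x (S \ C)) (K ∪ C)
      (Function.update w x c) := by
  have hlE : l.toFinset ⊆ E := fun y hy => hl (by simp_all)
  have hE : x ∈ E := hl (by simp)
  have hSl : S ⊆ l.toFinset := Finset.subset_union_left.trans hI.subset
  have hAE : S ∪ K ⊆ E := hI.subset.trans hlE
  have hAx : x ∉ S ∪ K := fun h => hx (List.mem_toFinset.1 (hI.subset h))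
  have hSx : x ∉ S := fun h => hAx (Finset.mem_union_left _ h)
  have hne : ∀ a ∈ l, Function.update w x c a = w a := fun a ha =>
    Function.update_of_ne (fun h => hx (by rwa [h] at ha)) _ _
  have hneA : ∀ a ∈ S ∪ K, Function.update w x c a = w a := fun a ha =>
    hne a (List.mem_toFinset.1 (hI.subset ha))
  have hS : ∀ A ⊆ S ∪ K, ∑ a ∈ A, Function.update w x c a = ∑ a ∈ A, w a := fun A hA =>
    Finset.sum_congr rfl fun a ha => hneA a (hA ha)
  have hAcc : insert x (S \ C) ∪ (K ∪ C) = insert x (S ∪ K) := by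
    ext a
    simp only [Finset.mem_union, Finset.mem_insert, Finset.mem_sdiff]
    have := @hCS a
    tauto
  have hc0 : 0 ≤ c := hc ▸ hf.marginal_nonneg (hSl.trans hlE) hE
  have hw0 : ∀ y, 0 ≤ Function.update w x c y := by
    intro y
    by_cases hy : y = x
    · rw [hy, Function.update_self]
      exact hc0
    · rw [Function.update_of_ne hy]
      exact hI.nonneg y
  have hU : 0 ≤ ∑ i ∈ M.idx x, u i := Finset.sum_nonneg fun i _ => hu i
  have hgU : 0 ≤ g * ∑ i ∈ M.idx x, u i := mul_nonneg hg hU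
  have hUc : ∑ i ∈ M.idx x, u i ≤ c := by linarith
  have hsumS : ∑ a ∈ insert x (S \ C), Function.update w x c a =
      c + (∑ a ∈ S, w a - ∑ a ∈ C, w a) := by
    rw [Finset.sum_insert fun h => hSx (Finset.mem_sdiff.1 h).1, Function.update_self,
      hS _ (Finset.sdiff_subset.trans Finset.subset_union_left), Finset.sum_sdiff_eq_sub hCS]
  have hC0 : 0 ≤ ∑ a ∈ C, w a := Finset.sum_nonneg fun a _ => hI.nonneg a
  have hKC : Disjoint K C := (hI.disjoint.mono_left hCS).symm
  have hsumK : ∑ a ∈ K ∪ C, Function.update w x c a = ∑ a ∈ K, w a + ∑ a ∈ C, w a := by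
    rw [hS _ (Finset.union_subset Finset.subset_union_right
      (hCS.trans Finset.subset_union_left)), Finset.sum_union hKC]
  have hmono : ∀ (t : ℝ) (B : Finset X), B ⊆ S ∪ K →
      (B.filter fun a => t ≤ w a) ⊆
        (insert x (S \ C) ∪ (K ∪ C)).filter fun a => t ≤ Function.update w x c a := by
    intro t B hB a ha
    rw [Finset.mem_filter] at ha
    rw [hAcc, Finset.mem_filter, hneA a (hB ha.1)]
    exact ⟨Finset.mem_insert_of_mem (hB ha.1), ha.2⟩
  refine ⟨?_, ?_, hind, hw0, ?_, ?_, ?_, ?_, ?_, ?_, ?_⟩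
  · rw [hAcc]
    intro y hy
    rcases Finset.mem_insert.1 hy with rfl | hy
    · simp
    · have := List.mem_toFinset.1 (hI.subset hy)
      simp [this]
  · rw [Finset.disjoint_insert_left, Finset.disjoint_union_right]
    exact ⟨fun h => hAx (by
      rcases Finset.mem_union.1 h with h | h
      · exact Finset.mem_union_right _ h
      · exact Finset.mem_union_left _ (hCS h)),
      hI.disjoint.mono_left Finset.sdiff_subset, Finset.sdiff_disjoint⟩
  -- With `w C ≤ U` and `(1 + g) * U ≤ c`, the loss `g * w C` is at most `c - w C`, the gain of the
  -- solution.
  · rw [hsumS, hsumK, mul_add]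
    have := hI.gain
    have := mul_le_mul_of_nonneg_left hC hg
    linarith
  · intro A hA
    have hsub : ∀ B ⊆ S \ C, ∑ a ∈ B, Function.update w x c a ≤ f B := fun B hB => by
      have hBS := hB.trans Finset.sdiff_subset
      rw [hS B (hBS.trans Finset.subset_union_left)]
      exact hI.weight_le B hBS
    by_cases hxA : x ∈ A
    · have hB := Finset.subset_insert_iff.1 hA
      rw [← Finset.add_sum_erase _ _ hxA, Function.update_self]
      have h1 := hsub _ hB
      have h2 := hf.marginal_le' (hB.trans Finset.sdiff_subset) (hSl.trans hlE) hE
      rw [Finset.insert_erase hxA] at h2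
      linarith
    · exact hsub A ((Finset.subset_insert_iff_of_notMem hxA).1 hA)
  · rw [hAcc, hsumS, hsumK]
    have h1 := hf.marginal_le' (Finset.subset_union_left (s₂ := K)) hAE hE
    have h2 := hI.value_le
    linarith
  · intro o ho
    rw [hAcc]
    rcases List.mem_append.1 ho with ho | ho
    · rw [hne o ho]
      exact (hf.marginal_le' (Finset.subset_insert x _) (Finset.insert_subset hE hAE)
        (hlE (List.mem_toFinset.2 ho))).trans (hI.marginal_le o ho)
    · rw [List.mem_singleton.1 ho, Finset.insert_eq_of_mem (Finset.mem_insert_self _ _), sub_self]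
      exact hw0 x
  · intro k hk o ho
    rcases List.mem_append.1 ho with ho | ho
    · rw [hne o ho]
      exact hI.singleton_le k hk o ho
    · rw [List.mem_singleton.1 ho, Function.update_self, hc]
      have := hk S (hSl.trans hlE) x (Finset.mem_sdiff.2 ⟨hE, hSx⟩)
      rwa [Finset.union_comm, ← Finset.insert_eq] at this
  · intro o ho hindo
    rcases List.mem_append.1 ho with ho | ho
    · obtain ⟨v, h1, h2, h3⟩ := hI.cover o ho hindo
      rw [hne o ho]
      exact ⟨v, h1, h2, fun i hi hv => M.cl_mono i _ _ o (hmono _ _ subset_rfl) (h3 i hi hv)⟩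
    · rw [List.mem_singleton.1 ho, Function.update_self]
      -- An accepted element spans itself at level `c`; one constraint on it is enough for the sum.
      refine ⟨fun _ => c, fun _ => hc0, ?_, fun i hi _ => M.cl_of_mem i _ x ?_ hi⟩
      · rw [Finset.sum_const, nsmul_eq_mul]
        have h1 : (1 : ℝ) ≤ (M.idx x).card := by exact_mod_cast hidx'.card_pos
        nlinarith [mul_le_mul_of_nonneg_right h1 hc0, mul_nonneg hg (mul_nonneg
          (zero_le_one.trans h1) hc0)]
      · rw [hAcc, Finset.mem_filter, Function.update_self]
        exact ⟨Finset.mem_insert_self _ _, le_rfl⟩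
  · rw [hAcc, hsumS, hsumK]
    classical
    have h1 : ∀ i, M.levelRank i (insert x (S ∪ K)) (Function.update w x c) ≤
        M.levelRank i (S ∪ K) w + if i ∈ M.idx x then ENNReal.ofReal (c - u i) else 0 := by
      intro i
      rw [← M.levelRank_congr i hneA]
      split_ifs with hi
      · have h2 := M.levelRank_insert_le (i := i) (A := S ∪ K) (x := x)
          (w := Function.update w x c) (u := u i) fun hui =>
            M.cl_mono i _ _ x (fun a ha => by
              rw [Finset.mem_filter] at ha ⊢
              have := Finset.mem_union_left K ha.1
              rw [hneA a this]
              exact ⟨this, ha.2⟩) (hcl i hi hui)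
        rwa [Function.update_self] at h2
      · rw [add_zero]
        exact M.levelRank_insert_of_notMem _ hi
    refine (Finset.sum_le_sum fun i _ => h1 i).trans ?_
    have hui : ∀ i ∈ M.idx x, 0 ≤ c - u i := fun i hi => by
      have := Finset.single_le_sum (f := u) (fun j _ => hu j) hi
      linarith
    rw [Finset.sum_add_distrib, Finset.sum_ite_mem, Finset.univ_inter,
      ← ENNReal.ofReal_sum_of_nonneg hui]
    have hp' : (1 : ℝ) ≤ p := by exact_mod_cast hp
    have hW : 0 ≤ ∑ a ∈ S, w a := Finset.sum_nonneg fun a _ => hI.nonneg a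
    have hk : 0 ≤ ∑ a ∈ K, w a := Finset.sum_nonneg fun a _ => hI.nonneg a
    refine (add_le_add hI.levelRank_le le_rfl).trans ?_
    rw [← ENNReal.ofReal_add (by
      have := mul_nonneg (sub_nonneg.2 hp') hk
      positivity) (Finset.sum_nonneg hui)]
    refine ENNReal.ofReal_le_ofReal ?_
    rw [Finset.sum_sub_distrib, Finset.sum_const, nsmul_eq_mul]
    have h2 : ((M.idx x).card : ℝ) * c ≤ p * c :=
      mul_le_mul_of_nonneg_right (by exact_mod_cast hidx) hc0
    nlinarith

/-- The weight of an independent set is at most `(1 + g) * (p * w S + (p - 1) * w K)`. -/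
theorem sum_weight_le (hp : 1 ≤ p) (hg : 0 ≤ g) (hI : ExchangeInvariant M p g E f l S K w)
    {T : Finset X} (hTl : T ⊆ l.toFinset) (hT : ∀ i, M.ind i T) :
    ∑ o ∈ T, w o ≤ (1 + g) * (p * ∑ x ∈ S, w x + (p - 1) * ∑ x ∈ K, w x) := by
  classical
  have hp' : (1 : ℝ) ≤ p := by exact_mod_cast hp
  have hW : 0 ≤ ∑ a ∈ S, w a := Finset.sum_nonneg fun a _ => hI.nonneg a
  have hk : 0 ≤ ∑ a ∈ K, w a := Finset.sum_nonneg fun a _ => hI.nonneg a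
  have hcov : ∀ o ∈ T, ∃ u : ι → ℝ, (∀ i, 0 ≤ u i) ∧
      w o ≤ (1 + g) * ∑ i ∈ M.idx o, u i ∧
      ∀ i ∈ M.idx o, 0 < u i → M.cl i ((S ∪ K).filter fun a => u i ≤ w a) o := fun o ho =>
    hI.cover o (List.mem_toFinset.1 (hTl ho)) fun i =>
      M.ind_mono i _ _ (Finset.singleton_subset_iff.2 ho) (hT i)
  choose! u hu0 hu1 hu2 using hcov
  have h1 : ∑ o ∈ T, ∑ i ∈ M.idx o, u o i ≤
      p * ∑ x ∈ S, w x + (p - 1) * ∑ x ∈ K, w x := by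
    -- The comparison is made in `[0, ∞]`, where `levelRank` takes its values; exchanging the sums
    -- leaves, for each `i`, the elements of `T` subject to constraint `i`.
    rw [← ENNReal.ofReal_le_ofReal_iff (by
      have := mul_nonneg (sub_nonneg.2 hp') hk
      positivity)]
    refine le_trans (le_of_eq ?_) ((Finset.sum_le_sum fun i _ =>
      M.sum_le_levelRank (i := i) (A := S ∪ K) (T := T.filter fun o => i ∈ M.idx o) (w := w)
        (u := fun o => u o i) (M.ind_mono i _ _ (Finset.filter_subset _ _) (hT i))
        (fun o ho => (Finset.mem_filter.1 ho).2)
        fun o ho h => hu2 o (Finset.mem_filter.1 ho).1 i (Finset.mem_filter.1 ho).2 h).trans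
      hI.levelRank_le)
    rw [ENNReal.ofReal_sum_of_nonneg fun o ho => Finset.sum_nonneg fun i _ => hu0 o ho i]
    rw [Finset.sum_congr rfl fun o ho => ENNReal.ofReal_sum_of_nonneg fun i _ => hu0 o ho i]
    simp only [Finset.sum_filter]
    rw [Finset.sum_comm]
    refine Finset.sum_congr rfl fun o _ => ?_
    rw [Finset.sum_ite_mem, Finset.univ_inter]
  calc ∑ o ∈ T, w o ≤ ∑ o ∈ T, (1 + g) * ∑ i ∈ M.idx o, u o i := Finset.sum_le_sum hu1
    _ = (1 + g) * ∑ o ∈ T, ∑ i ∈ M.idx o, u o i := by rw [Finset.mul_sum]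
    _ ≤ _ := mul_le_mul_of_nonneg_left h1 (by linarith)

/-- With `W` and `k` the weights of `S` and `K`, `f T ≤ (W + k) + 2 * (p * W + (p - 1) * k)`, and
`gain` says `k ≤ W`. -/
theorem value_le_of_one (hf : IsMonoSubmodular l.toFinset f) (hp : 1 ≤ p)
    (hI : ExchangeInvariant M p 1 l.toFinset f l S K w)
    {T : Finset X} (hTl : T ⊆ l.toFinset) (hT : ∀ i, M.ind i T) : f T ≤ 4 * p * f S := by
  have h1 := hI.sum_weight_le hp zero_le_one hTl hT
  have h2 := hf.le_add_sum hI.subset hTl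
  have h3 := Finset.sum_le_sum fun o ho => hI.marginal_le o (List.mem_toFinset.1 (hTl ho))
  have h4 := hI.value_le
  have h5 := hI.gain
  have h6 := hI.weight_le S subset_rfl
  have hp' : (1 : ℝ) ≤ p := by exact_mod_cast hp
  have h7 : 4 * (p : ℝ) * ∑ x ∈ S, w x ≤ 4 * p * f S :=
    mul_le_mul_of_nonneg_left h6 (by positivity)
  nlinarith

/-- Without the term `f (S ∪ K)` the factor is `(1 + g) * (p + (p - 1) / g)`, and the given `g`
minimizes it. -/
theorem value_le_of_curvature (hf : IsMonoSubmodular l.toFinset f) (hp : 1 ≤ p)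
    (hI : ExchangeInvariant M p (√((p : ℝ) * (p - 1)) / p) l.toFinset f l S K w)
    {T : Finset X} (hTl : T ⊆ l.toFinset) (hT : ∀ i, M.ind i T) :
    (1 - curvature l.toFinset f) * f T ≤ (2 * (p + √((p : ℝ) * (p - 1))) - 1) * f S := by
  have hp' : (1 : ℝ) ≤ p := by exact_mod_cast hp
  set s := √((p : ℝ) * (p - 1)) with hs
  have hs0 : 0 ≤ s := Real.sqrt_nonneg _
  have hs2 : s * s = p * (p - 1) := Real.mul_self_sqrt (mul_nonneg (by linarith) (by linarith))
  have h1 := hI.sum_weight_le hp (by positivity) hTl hT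
  have h2 := hf.one_sub_curvature_mul_le hTl
  have h3 := Finset.sum_le_sum fun o ho =>
    hI.singleton_le _ hf.curvatureBound_curvature o (List.mem_toFinset.1 (hTl ho))
  have h5 := hI.gain
  have h6 := hI.weight_le S subset_rfl
  set W := ∑ x ∈ S, w x
  set k := ∑ x ∈ K, w x
  have h7 : (2 * (p + s) - 1) * W ≤ (2 * (p + s) - 1) * f S :=
    mul_le_mul_of_nonneg_left h6 (by linarith)
  -- Written without division by `g`, since `g = 0` for `p = 1`; then the coefficient `p - 1` of `k`
  -- vanishes as well.
  have h8 : (1 + s / p) * (p * W + (p - 1) * k) =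
      (p + s) * W + (s * (s / p * k) + (p - 1) * (s / p * k)) := by
    have : s * (s / p * k) = (p - 1) * k := by
      field_simp
      rw [sq, hs2]
      ring
    rw [this]
    field_simp
  have h9 := mul_le_mul_of_nonneg_left h5 hs0
  have h10 := mul_le_mul_of_nonneg_left h5 (sub_nonneg.2 hp')
  rw [h8] at h1
  linarith

end ExchangeInvariant

/-! ### The exchange program -/

section ExchangeProgram

variable {X ι : Type} [DecidableEq X] {p : ℕ}

/-- The elements of a list of elements with slots. -/
def selected (L : List (X × ℕ)) : Finset X := (L.map Prod.fst).toFinset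

/-- The slots of a list of elements with slots. -/
def slots (L : List (X × ℕ)) : Finset ℕ := (L.map Prod.snd).toFinset

theorem mem_selected {L : List (X × ℕ)} {x : X} : x ∈ selected L ↔ ∃ a ∈ L, a.1 = x := by
  simp [selected]

omit [DecidableEq X] in
theorem mem_slots {L : List (X × ℕ)} {c : ℕ} : c ∈ slots L ↔ ∃ a ∈ L, a.2 = c := by
  simp [slots]

theorem selected_cons (a : X × ℕ) (L : List (X × ℕ)) :
    selected (a :: L) = insert a.1 (selected L) := by
  simp [selected]

theorem selected_filter (L : List (X × ℕ)) (C : Finset X) :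
    selected (L.filter fun a => decide (a.1 ∉ C)) = selected L \ C := by
  ext x
  simp only [mem_selected, Finset.mem_sdiff, List.mem_filter, decide_eq_true_eq]
  constructor
  · rintro ⟨a, ⟨h1, h2⟩, rfl⟩
    exact ⟨⟨a, h1, rfl⟩, h2⟩
  · rintro ⟨⟨a, h1, rfl⟩, h2⟩
    exact ⟨a, ⟨h1, h2⟩, rfl⟩

theorem sum_selected_le {w : X → ℝ} (hw : ∀ x, 0 ≤ w x) (C : List (X × ℕ)) :
    ∑ x ∈ selected C, w x ≤ (C.map fun a => w a.1).sum := by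
  induction C with
  | nil => simp [selected]
  | cons a C ih =>
    rw [selected_cons, List.map_cons, List.sum_cons]
    by_cases h : a.1 ∈ selected C
    · rw [Finset.insert_eq_of_mem h]
      linarith [hw a.1]
    · rw [Finset.sum_insert h]
      linarith

/-- Search for a conflict of `x` with the current solution at each of the given constraints.
The answer is `none` if `x` alone violates one of them. -/
def collectConflicts (pick : ι → List (X × ℕ) → X → QueryTree X p (Option (Option (X × ℕ))))
    (L : List (X × ℕ)) (x : X) : List ι → QueryTree X p (Option (List (X × ℕ)))
  | [] => .pure (some [])
  | i :: is => (pick i L x).bind fun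
    | none => .pure none
    | some o => (collectConflicts pick L x is).bind fun
      | none => .pure none
      | some C => .pure (some (o.toList ++ C))

/-- Process the element `x` for the current solution `L`: exchange it for its conflicts if its
marginal value is at least `1 + g` times their total weight. -/
noncomputable def exchangeStep
    (pick : ι → List (X × ℕ) → X → QueryTree X p (Option (Option (X × ℕ))))
    (idx : X → Finset ι) (avoid : Finset ℕ) (g : ℝ) (L : List (X × ℕ)) (x : X) :
    QueryTree X p (List (X × ℕ)) :=
  let k := freshNat (avoid ∪ slots L)
  .evalMarginal (selected L) x k <|
    (collectConflicts pick L x (idx x).toList).bind fun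
      | none => .pure L
      | some C => .test (slotForm k - (1 + g) • (C.map fun a => slotForm a.2).sum)
          (.pure ((x, k) :: L.filter fun a => decide (a.1 ∉ selected C)))
          (.pure L)

/-- The bit string for an element with a slot. -/
def encEntry (encX : X → List Bool) (a : X × ℕ) : List Bool :=
  bitPair (encX a.1) (Nat.bits a.2)

omit [DecidableEq X] in
theorem encEntry_injective {encX : X → List Bool} (hX : Function.Injective encX) :
    Function.Injective (encEntry encX) := by
  intro a b h
  obtain ⟨h1, h2⟩ := bitPair_inj h
  exact Prod.ext (hX h1) (bits_injective h2)

/-- The exchange program. It maintains two solutions, with different thresholds for exchanges,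
and returns the better one. -/
noncomputable def exchangeProgram
    (pick : ι → List (X × ℕ) → X → QueryTree X p (Option (Option (X × ℕ))))
    (idx : X → Finset ι) (g₀ g₁ : ℝ) (encX : X → List Bool) (hX : Function.Injective encX) :
    StreamProgram X p where
  State := List (X × ℕ) × List (X × ℕ)
  enc s := bitPair (bitList (encEntry encX) s.1) (bitList (encEntry encX) s.2)
  enc_injective s s' h := by
    obtain ⟨h1, h2⟩ := bitPair_inj h
    exact Prod.ext (bitList_injective (encEntry_injective hX) h1)
      (bitList_injective (encEntry_injective hX) h2)
  start := ([], [])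
  keep s := selected s.1 ∪ selected s.2
  item s x := (exchangeStep pick idx (slots s.2) g₀ s.1 x).bind fun L₀ =>
    (exchangeStep pick idx (slots L₀) g₁ s.2 x).bind fun L₁ => .pure (L₀, L₁)
  final s := .eval (selected s.1) 1 <| .eval (selected s.2) 0 <|
    .test (slotForm 0) (.pure (selected s.1)) (.pure (selected s.2))

/-- What the answer of a search for a conflict of `x` at the constraint `i` means. -/
def ConflictAnswer (M : ExchangeSystem X ι) (w : X → ℝ) (i : ι) (L : List (X × ℕ)) (x : X) :
    Option (Option (X × ℕ)) → Prop
  | none => ¬ M.ind i {x}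
  | some none => M.ind i (insert x (selected L))
  | some (some a) => a ∈ L ∧ M.cl i ((selected L).filter fun b => w a.1 ≤ w b) x ∧
      M.ind i (insert x (selected L \ {a.1}))

/-- The searches for conflicts are correct, and take at most `d` queries if the current solution
has at most `r` elements. -/
def FindsConflicts (M : ExchangeSystem X ι) (O : StreamOracles X p) (E : Finset X)
    (pick : ι → List (X × ℕ) → X → QueryTree X p (Option (Option (X × ℕ)))) (r d : ℕ) : Prop :=
  ∀ (L : List (X × ℕ)) (x : X) (store : Finset X) (R : ℕ) (reg : ℕ → ℝ) (w : X → ℝ) (i : ι),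
    insert x (selected L) ⊆ E → x ∉ selected L → (∀ i, M.ind i (selected L)) → L.length ≤ r →
    (∀ a ∈ L, slotValue reg a.2 = w a.1) → insert x (selected L) ⊆ store → i ∈ M.idx x →
    (pick i L x).Meets O store R (fun o reg' => reg' = reg ∧ ConflictAnswer M w i L x o) d 0 reg

variable {M : ExchangeSystem X ι} {O : StreamOracles X p} {E : Finset X}
  {pick : ι → List (X × ℕ) → X → QueryTree X p (Option (Option (X × ℕ)))} {r d : ℕ}

/-- The threshold `u i` is the weight of the conflict found at `i`, or `0` if there is none. An
element in conflict at several constraints is listed, and its weight counted, once for each. -/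
theorem meets_collectConflicts (hpick : FindsConflicts M O E pick r d) {L : List (X × ℕ)} {x : X}
    {store : Finset X} {R : ℕ} {reg : ℕ → ℝ} {w : X → ℝ} (hw : ∀ x, 0 ≤ w x)
    (hE : insert x (selected L) ⊆ E) (hx : x ∉ selected L) (hind : ∀ i, M.ind i (selected L))
    (hr : L.length ≤ r) (hreg : ∀ a ∈ L, slotValue reg a.2 = w a.1)
    (hst : insert x (selected L) ⊆ store) {is : List ι} (hnd : is.Nodup)
    (his : ∀ i ∈ is, i ∈ M.idx x) :
    (collectConflicts pick L x is).Meets O store R (fun o reg' => reg' = reg ∧ match o with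
      | none => ∃ i, ¬ M.ind i {x}
      | some C => (∀ a ∈ C, a ∈ L) ∧ ∃ u : ι → ℝ, (∀ i, 0 ≤ u i) ∧
          (C.map fun a => w a.1).sum = (is.map u).sum ∧
          (∀ i ∈ is, 0 < u i → M.cl i ((selected L).filter fun b => u i ≤ w b) x) ∧
          ∀ i ∈ is, M.ind i (insert x (selected L \ selected C))) (is.length * d) 0 reg := by
  classical
  induction is with
  | nil => exact .pure ⟨rfl, by simp, fun _ => 0, by simp, by simp, by simp, by simp⟩
  | cons i is ih =>
    rw [List.nodup_cons] at hnd
    have ih := ih hnd.2 fun j hj => his j (by simp [hj])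
    rw [List.length_cons, add_mul, one_mul, add_comm]
    refine (hpick L x store R reg w i hE hx hind hr hreg hst (his i (by simp))).bind
      (q' := 0) fun o reg' h => ?_
    obtain ⟨rfl, ho⟩ := h
    cases o with
    | none => exact .pure ⟨rfl, i, ho⟩
    | some o =>
      refine (ih.bind (d' := 0) (q' := 0) fun C reg' h => ?_)
      obtain ⟨rfl, hC⟩ := h
      cases C with
      | none => exact .pure ⟨rfl, hC⟩
      | some C =>
        obtain ⟨hCL, u, hu0, hu1, hu2, hu3⟩ := hC
        set t : ℝ := (o.map fun a => w a.1).getD 0 with ht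
        have ht0 : 0 ≤ t := by cases o <;> simp [ht, hw]
        have hne : ∀ j ∈ is, Function.update u i t j = u j := fun j hj =>
          Function.update_of_ne (fun h => hnd.1 (by rwa [h] at hj)) _ _
        refine .pure ⟨rfl, ?_, Function.update u i t, ?_, ?_, ?_, ?_⟩
        · intro a ha
          rcases List.mem_append.1 ha with ha | ha
          · rw [Option.mem_toList] at ha
            rw [ha] at ho
            exact ho.1
          · exact hCL a ha
        · intro j
          by_cases hj : j = i
          · rw [hj, Function.update_self]; exact ht0
          · rw [Function.update_of_ne hj]; exact hu0 j
        · rw [List.map_append, List.sum_append, List.map_cons, List.sum_cons,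
            Function.update_self, List.map_congr_left hne, hu1]
          cases o <;> simp [ht]
        · intro j hj hju
          rcases List.mem_cons.1 hj with rfl | hj
          · rw [Function.update_self] at hju ⊢
            cases o with
            | none => simp [ht] at hju
            | some a => exact ho.2.1
          · rw [hne j hj] at hju ⊢
            exact hu2 j hj hju
        · intro j hj
          rcases List.mem_cons.1 hj with rfl | hj
          · cases o with
            | none =>
              exact M.ind_mono _ _ _ (Finset.insert_subset_insert _ Finset.sdiff_subset) ho
            | some a =>
              refine M.ind_mono _ _ _ (Finset.insert_subset_insert _ ?_) ho.2.2
              refine Finset.sdiff_subset_sdiff subset_rfl (Finset.singleton_subset_iff.2 ?_)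
              exact mem_selected.2 ⟨a, by simp, rfl⟩
          · refine M.ind_mono _ _ _ (Finset.insert_subset_insert _ ?_) (hu3 j hj)
            refine Finset.sdiff_subset_sdiff subset_rfl fun b hb => ?_
            obtain ⟨a, ha, rfl⟩ := mem_selected.1 hb
            exact mem_selected.2 ⟨a, by simp [ha], rfl⟩

/-- The invariant of one solution of the exchange program: its slots hold the weights of its
elements. -/
def SolutionInvariant [Fintype ι] (M : ExchangeSystem X ι) (q : ℕ) (g : ℝ) (E : Finset X)
    (f : Finset X → ℝ) (B : ℕ) (l : List X) (L : List (X × ℕ)) (reg : ℕ → ℝ) : Prop :=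
  (L.map Prod.fst).Nodup ∧ (∀ c ∈ slots L, c ≤ B) ∧ ∃ K w,
    ExchangeInvariant M q g E f l (selected L) K w ∧ ∀ a ∈ L, slotValue reg a.2 = w a.1

omit [DecidableEq X] in
theorem card_slots_le (L : List (X × ℕ)) : (slots L).card ≤ L.length :=
  (List.toFinset_card_le _).trans (by simp)

theorem SolutionInvariant.congr [Fintype ι] {q : ℕ} {g : ℝ} {f : Finset X → ℝ} {B : ℕ}
    {l : List X} {L : List (X × ℕ)} {reg reg' : ℕ → ℝ}
    (h : SolutionInvariant M q g E f B l L reg)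
    (hreg : ∀ c ∈ slots L, slotValue reg' c = slotValue reg c) :
    SolutionInvariant M q g E f B l L reg' := by
  obtain ⟨h1, h2, K, w, h3, h4⟩ := h
  exact ⟨h1, h2, K, w, h3, fun a ha => by
    rw [hreg _ (mem_slots.2 ⟨a, ha, rfl⟩)]
    exact h4 a ha⟩

theorem SolutionInvariant.card_selected [Fintype ι] {q : ℕ} {g : ℝ} {f : Finset X → ℝ} {B : ℕ}
    {l : List X} {L : List (X × ℕ)} {reg : ℕ → ℝ}
    (h : SolutionInvariant M q g E f B l L reg) : (selected L).card = L.length := by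
  rw [selected, List.toFinset_card_of_nodup h.1, List.length_map]

/-- The fresh slot avoids those of both solutions, so the registers of the other one are
undisturbed. Besides the searches there are two evaluations and one comparison. -/
theorem meets_exchangeStep [Fintype ι] (hpick : FindsConflicts M O E pick r d)
    {f : Finset X → ℝ} (hf : IsMonoSubmodular E f) (hO : O.value = f) {q : ℕ} (hq : 1 ≤ q)
    {g : ℝ} (hg : 0 ≤ g) {avoid : Finset ℕ} {B R : ℕ} {l : List X} {L : List (X × ℕ)}
    {reg : ℕ → ℝ} {x : X} {store : Finset X} (hst : insert x (selected L) ⊆ store)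
    (hl : (l ++ [x]).toFinset ⊆ E) (hx : x ∉ l) (hidx : (M.idx x).card ≤ q)
    (hidx' : (M.idx x).Nonempty) (hr : L.length ≤ r) (hB : avoid.card + L.length ≤ B)
    (hR : 2 * B + 1 < R) (hI : SolutionInvariant M q g E f B l L reg) :
    (exchangeStep pick M.idx avoid g L x).Meets O store R (fun L' reg' =>
      SolutionInvariant M q g E f B (l ++ [x]) L' reg' ∧ selected L' ⊆ insert x (selected L) ∧
        ∀ c ∈ avoid, slotValue reg' c = slotValue reg c) (q * d + 3) 2 reg := by
  obtain ⟨hnd, hBL, K, w, hI, hreg⟩ := hI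
  have hSl : selected L ⊆ l.toFinset := Finset.subset_union_left.trans hI.subset
  have hSx : x ∉ selected L := fun h => hx (List.mem_toFinset.1 (hSl h))
  have hSE : insert x (selected L) ⊆ E := by
    refine Finset.insert_subset (hl (by simp)) (hSl.trans fun y hy => hl (by simp_all))
  have hk1 := freshNat_notMem (avoid ∪ slots L)
  have hk2 : freshNat (avoid ∪ slots L) ≤ B := by
    have h1 := freshNat_le (avoid ∪ slots L)
    have h2 := Finset.card_union_le avoid (slots L)
    have h3 := card_slots_le L
    omega
  unfold exchangeStep
  set k := freshNat (avoid ∪ slots L) with hk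
  rw [Finset.mem_union, not_or] at hk1
  have hqd : (M.idx x).toList.length * d + 1 ≤ q * d + 1 := by
    rw [Finset.length_toList]
    exact Nat.add_le_add_right (Nat.mul_le_mul_right _ hidx) 1
  refine QueryTree.Meets.mono (.evalMarginal hst (by omega)
    (d := (M.idx x).toList.length * d + 1) (q := 0)
    fun reg' hreg' => ?_) (fun _ _ h => h) (by omega) (by omega)
  rw [hO] at hreg'
  have hregL : ∀ a ∈ L, slotValue reg' a.2 = w a.1 := fun a ha => by
    rw [hreg', if_neg fun h => hk1.2 (by rw [← h]; exact mem_slots.2 ⟨a, ha, rfl⟩)]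
    exact hreg a ha
  have havoid : ∀ c ∈ avoid, slotValue reg' c = slotValue reg c := fun c hc => by
    rw [hreg', if_neg fun h => hk1.1 (by rwa [← h])]
  have hck : slotValue reg' k = f (insert x (selected L)) - f (selected L) := by
    rw [hreg', if_pos rfl]
  have hupd : ∀ a ∈ L, slotValue reg' a.2 = Function.update w x (slotValue reg' k) a.1 :=
    fun a ha => by
      rw [Function.update_of_ne fun h => hSx (mem_selected.2 ⟨a, ha, h⟩)]
      exact hregL a ha
  refine (meets_collectConflicts (R := R) hpick hI.nonneg hSE hSx hI.ind hr hregL hst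
    (Finset.nodup_toList _) (fun i hi => Finset.mem_toList.1 hi)).bind (q' := 0)
    fun o reg'' h => ?_
  obtain ⟨rfl, ho⟩ := h
  cases o with
  | none =>
    obtain ⟨i, hi⟩ := ho
    exact .pure ⟨⟨hnd, hBL, K, _, hI.reject hf hl hx hck fun h => absurd (h i) hi, hupd⟩,
      Finset.subset_insert _ _, havoid⟩
  | some C =>
    obtain ⟨hCL, u, hu0, hu1, hu2, hu3⟩ := ho
    have hlc : Finsupp.linearCombination ℝ reg''
        (slotForm k - (1 + g) • (C.map fun a => slotForm a.2).sum) =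
        slotValue reg'' k - (1 + g) * ∑ i ∈ M.idx x, u i := by
      rw [map_sub, map_smul, map_list_sum, List.map_map, linearCombination_slotForm, smul_eq_mul,
        ← Finset.sum_map_toList, ← hu1]
      congr 3
      refine List.map_congr_left fun a ha => ?_
      simp only [Function.comp, linearCombination_slotForm]
      exact hregL a (hCL a ha)
    have hcl : ∀ i ∈ M.idx x, 0 < u i →
        M.cl i ((selected L).filter fun a => u i ≤ w a) x := fun i hi hui =>
      hu2 i (Finset.mem_toList.2 hi) hui
    refine .test_form (fun h => .pure ⟨⟨?_, ?_, K ∪ selected C,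
      Function.update w x (slotValue reg'' k), ?_, ?_⟩, ?_, havoid⟩)
      (fun h => .pure ⟨⟨hnd, hBL, K, _, hI.reject hf hl hx hck fun _ => ⟨u, hu0, ?_, hcl⟩, hupd⟩,
        Finset.subset_insert _ _, havoid⟩)
    · rw [List.map_cons, List.nodup_cons]
      refine ⟨fun h => hSx ?_, hnd.sublist (List.filter_sublist.map _)⟩
      rw [selected, List.mem_toFinset]
      exact (List.filter_sublist.map _).subset h
    · intro c hc
      obtain ⟨a, ha, rfl⟩ := mem_slots.1 hc
      rcases List.mem_cons.1 ha with rfl | ha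
      · exact hk2
      · exact hBL _ (mem_slots.2 ⟨a, List.mem_of_mem_filter ha, rfl⟩)
    · rw [selected_cons, selected_filter]
      refine hI.accept hf hq hg hl hx hck hidx hidx' ?_ hu0 hcl ?_ ?_ ?_
      · intro b hb
        obtain ⟨a, ha, rfl⟩ := mem_selected.1 hb
        exact mem_selected.2 ⟨a, hCL a ha, rfl⟩
      · exact (sum_selected_le hI.nonneg C).trans (hu1.trans (Finset.sum_map_toList _ _)).le
      · rw [hlc] at h
        linarith
      · intro i
        by_cases hi : i ∈ M.idx x
        · exact hu3 i (Finset.mem_toList.2 hi)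
        · exact M.ind_insert_of_notMem i _ x hi
            (M.ind_mono i _ _ Finset.sdiff_subset (hI.ind i))
    · intro a ha
      rcases List.mem_cons.1 ha with rfl | ha
      · simp only [Function.update_self]
      · exact hupd a (List.mem_of_mem_filter ha)
    · rw [selected_cons, selected_filter]
      exact Finset.insert_subset_insert _ Finset.sdiff_subset
    · rw [hlc] at h
      linarith

theorem meets_exchangeProgram_item [Fintype ι] (hpick : FindsConflicts M O E pick r d)
    {f : Finset X → ℝ} (hf : IsMonoSubmodular E f) (hO : O.value = f) {q : ℕ} (hq : 1 ≤ q)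
    {g₀ g₁ : ℝ} (hg₀ : 0 ≤ g₀) (hg₁ : 0 ≤ g₁) {encX : X → List Bool}
    {hX : Function.Injective encX} {l : List X} {s : List (X × ℕ) × List (X × ℕ)}
    {reg : ℕ → ℝ} {x : X} (hl : (l ++ [x]).toFinset ⊆ E) (hx : x ∉ l)
    (hidx : (M.idx x).card ≤ q) (hidx' : (M.idx x).Nonempty)
    (hr : ∀ T ⊆ E, (∀ i, M.ind i T) → T.card ≤ r)
    (hI : SolutionInvariant M q g₀ E f (2 * r) l s.1 reg ∧
      SolutionInvariant M q g₁ E f (2 * r) l s.2 reg) :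
    ((exchangeProgram pick M.idx g₀ g₁ encX hX).item s x).Meets O
      (insert x (selected s.1 ∪ selected s.2)) (4 * r + 2)
      (fun s' reg' => selected s'.1 ∪ selected s'.2 ⊆ insert x (selected s.1 ∪ selected s.2) ∧
        SolutionInvariant M q g₀ E f (2 * r) (l ++ [x]) s'.1 reg' ∧
          SolutionInvariant M q g₁ E f (2 * r) (l ++ [x]) s'.2 reg')
      (2 * (q * d + 3)) 4 reg := by
  have hlen : ∀ {g l L reg}, l.toFinset ⊆ E → SolutionInvariant M q g E f (2 * r) l L reg →
      L.length ≤ r := by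
    intro g l L reg hl h
    rw [← h.card_selected]
    obtain ⟨_, _, K, w, h, _⟩ := h
    exact hr _ ((Finset.subset_union_left.trans h.subset).trans hl) h.ind
  have hlE : l.toFinset ⊆ E := fun y hy => hl (by simp_all)
  obtain ⟨h0, h1⟩ := hI
  have hl0 := hlen hlE h0
  have hl1 := hlen hlE h1
  have hs1 := card_slots_le s.2
  rw [two_mul (q * d + 3)]
  refine (meets_exchangeStep hpick hf hO hq hg₀ (avoid := slots s.2) (B := 2 * r)
    (Finset.insert_subset_insert _ Finset.subset_union_left) hl hx hidx hidx' hl0 (by omega)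
    (by omega) h0).bind (q' := 2) fun L₀ reg' h => ?_
  obtain ⟨h0', hsub0, hav0⟩ := h
  have hl0' := hlen hl h0'
  have hs0' := card_slots_le L₀
  refine QueryTree.Meets.bind (d' := 0) (q' := 0) (meets_exchangeStep hpick hf hO hq hg₁
    (avoid := slots L₀) (B := 2 * r)
    (Finset.insert_subset_insert _ Finset.subset_union_right) hl hx hidx hidx' hl1 (by omega)
    (by omega) (h1.congr hav0)) fun L₁ reg'' h => ?_
  obtain ⟨h1', hsub1, hav1⟩ := h
  refine .pure ⟨Finset.union_subset ?_ ?_, h0'.congr hav1, h1'⟩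
  · exact hsub0.trans (Finset.insert_subset_insert _ Finset.subset_union_left)
  · exact hsub1.trans (Finset.insert_subset_insert _ Finset.subset_union_right)

theorem meets_exchangeProgram_final {g₀ g₁ : ℝ} {idx : X → Finset ι} {encX : X → List Bool}
    {hX : Function.Injective encX} {s : List (X × ℕ) × List (X × ℕ)} {reg : ℕ → ℝ}
    {P : Finset X → Prop} {R : ℕ} (hR : 2 ≤ R)
    (h0 : O.value (selected s.2) ≤ O.value (selected s.1) → P (selected s.1))
    (h1 : O.value (selected s.1) ≤ O.value (selected s.2) → P (selected s.2)) :
    ((exchangeProgram pick idx g₀ g₁ encX hX).final s).Meets O (selected s.1 ∪ selected s.2) R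
      (fun S _ => S ⊆ selected s.1 ∪ selected s.2 ∧ P S) 3 4 reg := by
  -- Registers `0` and `1` may be overwritten, as no weight is needed any more; slot `0` then holds
  -- the difference of the two values.
  refine QueryTree.Meets.mono (d := 0 + 1 + 1 + 1) (q := 0 + 1 + 1)
    (.eval Finset.subset_union_left (by omega) (.eval Finset.subset_union_right (by omega)
      (.test_form (fun h => .pure ⟨Finset.subset_union_left, h0 ?_⟩)
        fun h => .pure ⟨Finset.subset_union_right, h1 ?_⟩))) (fun _ _ h => h) (by omega)
          (by omega)
  all_goals
    rw [linearCombination_slotForm] at h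
    simp [slotValue] at h
    linarith

theorem exchangeProgram_correct [Fintype ι] {σ : List X} (hσ : σ.Nodup)
    (hpick : FindsConflicts M O σ.toFinset pick r d) {f : Finset X → ℝ}
    (hf : IsMonoSubmodular σ.toFinset f) (hO : O.value = f) {q : ℕ} (hq : 1 ≤ q)
    {encX : X → List Bool} (hX : Function.Injective encX) {bX : ℕ}
    (hbX : ∀ x ∈ σ, (encX x).length ≤ bX)
    (hidx : ∀ x ∈ σ, (M.idx x).card ≤ q ∧ (M.idx x).Nonempty)
    (hr : ∀ T ⊆ σ.toFinset, (∀ i, M.ind i T) → T.card ≤ r) :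
    ((exchangeProgram pick M.idx (√((q : ℝ) * (q - 1)) / q) 1 encX hX).toAlg encX hX).RunsWithin
      O σ (4 * r + 2)
      (2 * (3 * (r * (2 * (2 * bX + 1 + (Nat.log 2 (2 * r) + 1)) + 1)) + 1) + 2 * bX +
        2 * (q * d + 3) + 5) (4 * (σ.length + 1)) ∧
    ∃ I, ((exchangeProgram pick M.idx (√((q : ℝ) * (q - 1)) / q) 1 encX hX).toAlg encX
      hX).Outputs O σ I ∧
      IsApproxMax σ.toFinset (fun S => ∀ i, M.ind i S) f
        (curvatureRatio (4 * q) (2 * (q + √((q : ℝ) * (q - 1))) - 1) (curvature σ.toFinset f))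
        I := by
  have hq' : (1 : ℝ) ≤ q := by exact_mod_cast hq
  have hlen : ∀ {g l L reg}, SolutionInvariant M q g σ.toFinset f (2 * r) l L reg →
      l.toFinset ⊆ σ.toFinset → L.length ≤ r := by
    intro g l L reg h hl
    rw [← h.card_selected]
    obtain ⟨_, _, K, w, h, _⟩ := h
    exact hr _ ((Finset.subset_union_left.trans h.subset).trans hl) h.ind
  have hbits : ∀ {g l L reg}, SolutionInvariant M q g σ.toFinset f (2 * r) l L reg →
      l.toFinset ⊆ σ.toFinset → (bitList (encEntry encX) L).length ≤
        r * (2 * (2 * bX + 1 + (Nat.log 2 (2 * r) + 1)) + 1) := by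
    intro g l L reg h hl
    have h1 := hlen h hl
    obtain ⟨_, h2, K, w, h, _⟩ := h
    refine (length_bitList_le (b := 2 * bX + 1 + (Nat.log 2 (2 * r) + 1)) fun a ha => ?_).trans
      (Nat.mul_le_mul_right _ h1)
    have h3 := hbX a.1 (List.mem_toFinset.1 (hl ((Finset.subset_union_left.trans h.subset)
      (mem_selected.2 ⟨a, ha, rfl⟩))))
    have h4 := length_bits_le (h2 a.2 (mem_slots.2 ⟨a, ha, rfl⟩))
    rw [encEntry, length_bitPair]
    omega
  have h0 : ∀ g, SolutionInvariant M q g σ.toFinset f (2 * r) [] [] fun _ => 0 := fun g =>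
    ⟨by simp, by simp [slots], ∅, _, .nil hf, by simp⟩
  refine StreamProgram.toAlg_correct
    (exchangeProgram pick M.idx (√((q : ℝ) * (q - 1)) / q) 1 encX hX) hX
    (Inv := fun l s reg => l.toFinset ⊆ σ.toFinset ∧
      SolutionInvariant M q (√((q : ℝ) * (q - 1)) / q) σ.toFinset f (2 * r) l s.1 reg ∧
      SolutionInvariant M q 1 σ.toFinset f (2 * r) l s.2 reg) ?_
    ⟨by simp, h0 _, h0 _⟩ ?_ ?_ ?_ hbX
  · simp [exchangeProgram, selected]
  · rintro l x t hl s reg ⟨_, hI⟩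
    have hsub : (l ++ [x]).toFinset ⊆ σ.toFinset := by
      intro y hy
      rw [hl]
      simp only [List.mem_toFinset, List.mem_append, List.mem_cons] at hy ⊢
      tauto
    have hxσ : x ∈ σ := by simp [hl]
    have hnew : x ∉ l := by
      rw [hl] at hσ
      exact fun h => List.disjoint_of_nodup_append hσ h (by simp)
    exact (meets_exchangeProgram_item hpick hf hO hq (by positivity) zero_le_one hsub hnew
      (hidx x hxσ).1 (hidx x hxσ).2 hr hI).mono (fun s' reg' h => ⟨h.1, hsub, h.2⟩) le_rfl le_rfl
  · rintro s reg ⟨_, hI0, hI1⟩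
    obtain ⟨_, _, K0, w0, hI0, _⟩ := hI0
    obtain ⟨_, _, K1, w1, hI1, _⟩ := hI1
    have hlin := fun T hT hTI => hI0.value_le_of_curvature (T := T) hf hq hT hTI
    have hsub := fun T hT hTI => hI1.value_le_of_one (T := T) hf hq hT hTI
    have hs0 : 0 ≤ √((q : ℝ) * (q - 1)) := Real.sqrt_nonneg _
    have hb : 0 < 2 * (q + √((q : ℝ) * (q - 1))) - 1 := by linarith
    refine (meets_exchangeProgram_final (by omega) (fun h => ?_) fun h => ?_).mono
      (fun _ _ h => h) (by omega) le_rfl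
    -- Each solution satisfies one of the two estimates. Both are linear in the value of the
    -- solution, so the better solution satisfies both.
    all_goals rw [hO] at h
    · refine isApproxMax_of_bounds (by positivity) hb
        (Finset.subset_union_left.trans hI0.subset) hI0.ind (fun T hT hTI => ?_) hlin
      exact (hsub T hT hTI).trans (mul_le_mul_of_nonneg_left h (by positivity))
    · refine isApproxMax_of_bounds (by positivity) hb
        (Finset.subset_union_left.trans hI1.subset) hI1.ind hsub (fun T hT hTI => ?_)
      exact (hlin T hT hTI).trans (mul_le_mul_of_nonneg_left h hb.le)
  · rintro l s reg ⟨hl, hI0, hI1⟩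
    have e0 := hlen hI0 hl
    have e1 := hlen hI1 hl
    have b0 := hbits hI0 hl
    have b1 := hbits hI1 hl
    refine ⟨?_, ?_⟩
    · have := Finset.card_union_le (selected s.1) (selected s.2)
      rw [hI0.card_selected, hI1.card_selected] at this
      change (selected s.1 ∪ selected s.2).card + 1 ≤ _
      omega
    · change (bitPair _ _).length ≤ _
      rw [length_bitPair]
      omega

end ExchangeProgram

/-! ### Hypermatchings -/

section Incidence

variable {X ι : Type} [DecidableEq X] [DecidableEq ι]

open Classical in
/-- The exchange system of pairwise non-incident sets: for each `i`, at most one element is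
incident to `i`. -/
noncomputable def incidenceSystem (inc : X → Finset ι) : ExchangeSystem X ι where
  idx := inc
  ind i A := ∀ a ∈ A, ∀ b ∈ A, i ∈ inc a → i ∈ inc b → a = b
  cl i A x := i ∈ inc x ∧ ∃ a ∈ A, i ∈ inc a
  rk i A := if ∃ a ∈ A, i ∈ inc a then 1 else 0
  ind_empty := by simp
  ind_mono i A B h hB a ha b hb := hB a (h ha) b (h hb)
  ind_insert_of_notMem i A x hx hA a ha b hb hai hbi := by
    refine hA a (Finset.mem_of_mem_insert_of_ne ha ?_) b
      (Finset.mem_of_mem_insert_of_ne hb ?_) hai hbi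
    · rintro rfl; exact hx hai
    · rintro rfl; exact hx hbi
  cl_mono i A B x h := fun ⟨h1, a, h2, h3⟩ => ⟨h1, a, h h2, h3⟩
  cl_of_mem i A x hx hi := ⟨hi, x, hx, hi⟩
  rk_empty := by simp
  rk_insert_le i A x := by
    split_ifs <;> simp
  rk_insert_of_notMem i A x hx := by
    simp [hx]
  rk_insert_of_cl i A x := by
    rintro ⟨-, h⟩
    rw [if_pos h]
    split_ifs <;> simp
  card_le i A T hT hA := by
    rcases T.eq_empty_or_nonempty with rfl | ⟨o, ho⟩
    · simp
    · rw [if_pos (hA o ho).2.2]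
      have : T.card ≤ 1 := Finset.card_le_one.2 fun a ha b hb =>
        hT a ha b hb (hA a ha).1 (hA b hb).1
      exact_mod_cast this

/-- The search for an element of the current solution that is incident to `i`. -/
def incidentPick (inc : X → Finset ι) (i : ι) (L : List (X × ℕ)) (_ : X) :
    QueryTree X 0 (Option (Option (X × ℕ))) :=
  .pure (some (L.find? fun a => decide (i ∈ inc a.1)))

/-- The solution has at most one element incident to `i`, so the first one found is the only
conflict there, and no oracle is asked. -/
theorem findsConflicts_incidentPick (inc : X → Finset ι) (O : StreamOracles X 0) (E : Finset X)
    (r : ℕ) : FindsConflicts (incidenceSystem inc) O E (incidentPick inc) r 0 := by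
  intro L x store R reg w i hE hx hind hr hreg hst hi
  refine .pure ⟨rfl, ?_⟩
  change i ∈ inc x at hi
  have hind : ∀ a ∈ selected L, ∀ b ∈ selected L, i ∈ inc a → i ∈ inc b → a = b := hind i
  cases hfind : L.find? fun a => decide (i ∈ inc a.1) with
  | none =>
    rw [List.find?_eq_none] at hfind
    have hno : ∀ a ∈ selected L, i ∉ inc a := fun a ha => by
      obtain ⟨b, hb, rfl⟩ := mem_selected.1 ha
      simpa using hfind b hb
    change ∀ a ∈ insert x (selected L), ∀ b ∈ insert x (selected L), i ∈ inc a → i ∈ inc b → a = b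
    intro a ha b hb hai hbi
    rw [Finset.mem_insert] at ha hb
    rw [ha.resolve_right fun h => hno a h hai, hb.resolve_right fun h => hno b h hbi]
  | some a =>
    have haL : a ∈ L := List.mem_of_find?_eq_some hfind
    have hai : i ∈ inc a.1 := by simpa using List.find?_some hfind
    have haS : a.1 ∈ selected L := mem_selected.2 ⟨a, haL, rfl⟩
    refine ⟨haL, ⟨hi, a.1, by simp [haS], hai⟩, ?_⟩
    change ∀ b ∈ insert x (selected L \ {a.1}), ∀ c ∈ insert x (selected L \ {a.1}),
      i ∈ inc b → i ∈ inc c → b = c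
    have hno : ∀ b ∈ insert x (selected L \ {a.1}), i ∈ inc b → b = x := by
      intro b hb hbi
      rcases Finset.mem_insert.1 hb with hb | hb
      · exact hb
      · rw [Finset.mem_sdiff, Finset.mem_singleton] at hb
        exact absurd (hind b hb.1 a.1 haS hbi hai) hb.2
    intro b hb c hc hbi hci
    rw [hno b hb hbi, hno c hc hci]

theorem card_le_of_incidenceSystem [Fintype ι] {inc : X → Finset ι} {T : Finset X}
    (hinc : ∀ x ∈ T, (inc x).Nonempty) (hT : ∀ i, (incidenceSystem inc).ind i T) :
    T.card ≤ Fintype.card ι := by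
  choose g hg using hinc
  rw [← Fintype.card_coe T]
  refine Fintype.card_le_of_injective (fun x : T => g x x.2) fun a b hab => Subtype.ext ?_
  exact hT _ a a.2 b b.2 (hg a a.2) (by rw [show g a a.2 = g b b.2 from hab]; exact hg b b.2)

end Incidence

/-! ### Hyperedges as incidence constraints -/

section Hypermatching

variable {n : ℕ}

/-- The constraints on a hyperedge: its vertices, and one more for the empty hyperedge. -/
def edgeIncidence (e : Finset (Fin n)) : Finset (Option (Fin n)) :=
  if e = ∅ then {none} else e.map Function.Embedding.some

theorem edgeIncidence_nonempty (e : Finset (Fin n)) : (edgeIncidence e).Nonempty := by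
  unfold edgeIncidence
  split_ifs with h
  · simp
  · simpa using Finset.nonempty_iff_ne_empty.2 h

theorem card_edgeIncidence_le {p : ℕ} (hp : 1 ≤ p) {e : Finset (Fin n)} (he : e.card ≤ p) :
    (edgeIncidence e).card ≤ p := by
  unfold edgeIncidence
  split_ifs with h
  · simpa using hp
  · simpa using he

/-- The extra constraint `none` concerns the empty hyperedge alone. It never causes a conflict, but
it makes every constraint set nonempty, as `accept` requires. -/
theorem isHyperMatching_iff {T : Finset (Finset (Fin n))} :
    (∀ i, (incidenceSystem edgeIncidence).ind i T) ↔ IsHyperMatching T := by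
  constructor
  · intro h e he e' he' hne
    rw [Finset.disjoint_left]
    intro v hv hv'
    refine hne (h (some v) e he e' he' ?_ ?_)
    · rw [edgeIncidence, if_neg (Finset.ne_empty_of_mem hv)]
      simpa using hv
    · rw [edgeIncidence, if_neg (Finset.ne_empty_of_mem hv')]
      simpa using hv'
  · intro h i e he e' he' hi hi'
    by_contra hne
    have hd := Finset.disjoint_left.1 (h e he e' he' hne)
    unfold edgeIncidence at hi hi'
    split_ifs at hi hi' with h1 h2 h2
    · exact hne (h1.trans h2.symm)
    · rw [Finset.mem_singleton] at hi
      subst hi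
      simp at hi'
    · rw [Finset.mem_singleton] at hi'
      subst hi'
      simp at hi
    · rw [Finset.mem_map] at hi hi'
      obtain ⟨v, hv, rfl⟩ := hi
      obtain ⟨v', hv', hvv⟩ := hi'
      simp only [Function.Embedding.some_apply, Option.some_inj] at hvv
      rw [hvv] at hv'
      exact hd hv hv'

/-- The bit string for a hyperedge. -/
noncomputable def encHyperedge (e : Finset (Fin n)) : List Bool :=
  bitList (fun v : Fin n => Nat.bits v) e.toList

theorem encHyperedge_injective : Function.Injective (encHyperedge (n := n)) := by
  intro e e' h
  have := bitList_injective (fun a b h => Fin.ext (bits_injective h)) h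
  rw [← Finset.toList_toFinset e, this, Finset.toList_toFinset]

theorem length_encHyperedge_le {p : ℕ} {e : Finset (Fin n)} (he : e.card ≤ p) :
    (encHyperedge e).length ≤ p * (2 * (Nat.log 2 (n + 1) + 1) + 1) := by
  refine (length_bitList_le fun v _ => length_bits_le (v.2.le.trans n.le_succ)).trans ?_
  rw [Finset.length_toList]
  exact Nat.mul_le_mul_right _ he

theorem exists_hypermatching_alg {p : ℕ} (hp : 1 ≤ p) (n : ℕ) :
    ∃ A : StreamAlg (Finset (Fin n)) 0,
      ∀ σ : List (Finset (Fin n)), σ.Nodup → (∀ e ∈ σ, e.card ≤ p) →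
      ∀ f : Finset (Finset (Fin n)) → ℝ, IsMonoSubmodular σ.toFinset f →
        A.RunsWithin ⟨f, fun i => i.elim0⟩ σ
          (200 * p * (n + 1)) (200 * p * (n + 1) * (Nat.log 2 (n + 1) + 1))
          (200 * p * (σ.length + 1)) ∧
        ∃ M, A.Outputs ⟨f, fun i => i.elim0⟩ σ M ∧
          IsApproxMax σ.toFinset IsHyperMatching f
            (curvatureRatio (4 * p) (2 * (p + √((p : ℝ) * (p - 1))) - 1)
              (curvature σ.toFinset f)) M := by
  refine ⟨(exchangeProgram (incidentPick edgeIncidence) edgeIncidence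
    (√((p : ℝ) * (p - 1)) / p) 1 encHyperedge encHyperedge_injective).toAlg encHyperedge
    encHyperedge_injective, fun σ hσ hcard f hf => ?_⟩
  obtain ⟨h1, I, h2, h3⟩ := exchangeProgram_correct (M := incidenceSystem edgeIncidence)
    (O := ⟨f, fun i => i.elim0⟩) hσ (findsConflicts_incidentPick edgeIncidence _ _ (n + 1)) hf rfl
    hp encHyperedge_injective (fun e he => length_encHyperedge_le (hcard e he))
    (fun e he => ⟨card_edgeIncidence_le hp (hcard e he), edgeIncidence_nonempty e⟩)
    (fun T _ hT => by
      simpa using card_le_of_incidenceSystem (fun e _ => edgeIncidence_nonempty e) hT)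
  simp only [isHyperMatching_iff] at h3
  refine ⟨h1.mono ?_ ?_ ?_, I, h2, h3⟩
  · have : n + 1 ≤ p * (n + 1) := Nat.le_mul_of_pos_left _ hp
    rw [mul_assoc]
    omega
  · rw [mul_comm 2 (n + 1), Nat.log_mul_base (by norm_num) (by omega)]
    set B := Nat.log 2 (n + 1) + 1
    have hB : 1 ≤ B := by omega
    have hpB : 1 ≤ p * B := Nat.mul_pos hp hB
    have hBp : B ≤ p * B := Nat.le_mul_of_pos_left _ hp
    have hpp : p ≤ p * B := Nat.le_mul_of_pos_right _ hB
    have e1 : p * (2 * B + 1) ≤ 3 * (p * B) := by rw [mul_add]; linarith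
    have e2 : (n + 1) * (2 * (2 * (p * (2 * B + 1)) + 1 + (B + 1)) + 1) ≤
        (n + 1) * (20 * (p * B)) := Nat.mul_le_mul_left _ (by omega)
    have e3 : p * B ≤ (n + 1) * (p * B) := Nat.le_mul_of_pos_left _ (by omega)
    have e4 : 200 * p * (n + 1) * B = 200 * ((n + 1) * (p * B)) := by ring
    have e5 : (n + 1) * (20 * (p * B)) = 20 * ((n + 1) * (p * B)) := by ring
    rw [e4]
    omega
  · exact Nat.mul_le_mul_right _ (by omega)

end Hypermatching

/-! ### Intersections of matroids -/

section MatroidIntersection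

variable {X : Type} [DecidableEq X] {p : ℕ}

/-- The exchange system of the common independent sets of matroids. -/
noncomputable def matroidSystem (Mat : Fin p → Matroid X) : ExchangeSystem X (Fin p) where
  idx _ := Finset.univ
  ind i A := (Mat i).Indep A
  cl i A x := x ∈ A ∨ x ∈ (Mat i).closure A
  rk i A := ((Mat i).eRk A).toENNReal
  ind_empty i := by simp
  ind_mono i A B h hB := hB.subset (Finset.coe_subset.2 h)
  ind_insert_of_notMem i A x hx := absurd (Finset.mem_univ i) hx
  cl_mono i A B x h := Or.imp (fun hx => h hx) fun hx =>
    (Mat i).closure_subset_closure (Finset.coe_subset.2 h) hx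
  cl_of_mem i A x hx _ := .inl hx
  rk_empty i := by simp
  rk_insert_le i A x := by
    have := (Mat i).eRk_insert_le_add_one x A
    rw [Finset.coe_insert]
    exact (ENat.toENNReal_mono this).trans (by simp)
  rk_insert_of_notMem i A x hx := absurd (Finset.mem_univ i) hx
  rk_insert_of_cl i A x := by
    rintro (hx | hx)
    · rw [Finset.insert_eq_of_mem hx]
    · rw [Finset.coe_insert, ← (Mat i).eRk_closure_eq (insert x (A : Set X)),
        Matroid.closure_insert_eq_of_mem_closure hx, Matroid.eRk_closure_eq]
  card_le i A T hT hA := by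
    have hsub : (T : Set X) ⊆ (Mat i).closure A := fun o ho =>
      (hA o ho).2.elim (fun h => (Mat i).mem_closure_of_mem' h (hT.subset_ground ho)) id
    have h1 := hT.encard_le_eRk_of_subset hsub
    rw [Matroid.eRk_closure_eq, Set.encard_coe_eq_coe_finsetCard] at h1
    simpa using ENat.toENNReal_mono h1

/-- Go through a list of elements of the current solution and determine one of minimum weight
among those that can be exchanged for `x`, and the previous candidate `best`. -/
noncomputable def exchangeScan (i : Fin p) (S : Finset X) (x : X) :
    List (X × ℕ) → Option (X × ℕ) → QueryTree X p (Option (X × ℕ))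
  | [], best => .pure best
  | a :: t, none => .indep i ((insert x S).erase a.1) (exchangeScan i S x t (some a))
      (exchangeScan i S x t none)
  | a :: t, some b => .indep i ((insert x S).erase a.1)
      (.test (slotForm b.2 - slotForm a.2) (exchangeScan i S x t (some a))
        (exchangeScan i S x t (some b)))
      (exchangeScan i S x t (some b))

/-- Loop invariant of a minimum search, for an arbitrary candidate `best`. An element costs one
independence query and at most one comparison of weights. -/
theorem meets_exchangeScan {O : StreamOracles X p} {i : Fin p} {S store : Finset X} {x : X}
    {R : ℕ} {reg : ℕ → ℝ} (hst : insert x S ⊆ store) (t : List (X × ℕ))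
    (best : Option (X × ℕ)) :
    (exchangeScan i S x t best).Meets O store R (fun o reg' => reg' = reg ∧
      (o = none → best = none ∧ ∀ a ∈ t, ¬ O.isIndep i ((insert x S).erase a.1)) ∧
      ∀ b, o = some b → (best = some b ∨ b ∈ t ∧ O.isIndep i ((insert x S).erase b.1)) ∧
        (∀ c, best = some c → slotValue reg b.2 ≤ slotValue reg c.2) ∧
        ∀ a ∈ t, O.isIndep i ((insert x S).erase a.1) → slotValue reg b.2 ≤ slotValue reg a.2)
      (2 * t.length) 0 reg := by
  induction t generalizing best with
  | nil =>
    refine .pure ⟨rfl, fun h => ⟨h, by simp⟩, fun b h => ⟨.inl h, fun c hc => ?_, by simp⟩⟩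
    rw [hc, Option.some_inj] at h
    rw [h]
  | cons a t ih =>
    have hst' : (insert x S).erase a.1 ⊆ store := (Finset.erase_subset _ _).trans hst
    cases best with
    | none =>
      refine QueryTree.Meets.mono (d := 2 * t.length + 1) (q := 0) (.indep hst' ?_)
        (fun _ _ h => h) (by rw [List.length_cons]; omega) le_rfl
      by_cases ha : O.isIndep i ((insert x S).erase a.1)
      · rw [if_pos ha]
        refine (ih (some a)).mono (fun o reg' h => ⟨h.1, fun ho => ?_, fun b hb => ?_⟩) le_rfl le_rfl
        · exact absurd (h.2.1 ho).1 (by simp)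
        · obtain ⟨h1, h2, h3⟩ := h.2.2 b hb
          refine ⟨.inr ?_, by simp, ?_⟩
          · rcases h1 with h1 | h1
            · rw [Option.some_inj] at h1
              subst h1
              exact ⟨by simp, ha⟩
            · exact ⟨by simp [h1.1], h1.2⟩
          · intro c hc hci
            rcases List.mem_cons.1 hc with rfl | hc
            · exact h2 _ rfl
            · exact h3 c hc hci
      · rw [if_neg ha]
        refine (ih none).mono (fun o reg' h => ⟨h.1, fun ho => ⟨rfl, ?_⟩, fun b hb => ?_⟩) le_rfl
          le_rfl
        · intro c hc
          rcases List.mem_cons.1 hc with rfl | hc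
          · exact ha
          · exact (h.2.1 ho).2 c hc
        · obtain ⟨h1, h2, h3⟩ := h.2.2 b hb
          refine ⟨.inr ?_, by simp, ?_⟩
          · rcases h1 with h1 | h1
            · simp at h1
            · exact ⟨by simp [h1.1], h1.2⟩
          · intro c hc hci
            rcases List.mem_cons.1 hc with rfl | hc
            · exact absurd hci ha
            · exact h3 c hc hci
    | some b₀ =>
      have keep : (¬ O.isIndep i ((insert x S).erase a.1) ∨
          slotValue reg b₀.2 ≤ slotValue reg a.2) → _ := fun hcase =>
        (ih (some b₀)).mono (Q' := fun o reg' => reg' = reg ∧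
          (o = none → some b₀ = none ∧ ∀ c ∈ a :: t, ¬ O.isIndep i ((insert x S).erase c.1)) ∧
          ∀ b, o = some b →
            (some b₀ = some b ∨ b ∈ a :: t ∧ O.isIndep i ((insert x S).erase b.1)) ∧
            (∀ c, some b₀ = some c → slotValue reg b.2 ≤ slotValue reg c.2) ∧
            ∀ c ∈ a :: t, O.isIndep i ((insert x S).erase c.1) →
              slotValue reg b.2 ≤ slotValue reg c.2) (fun o reg' h =>
          ⟨h.1, fun ho => absurd (h.2.1 ho).1 (by simp), fun b hb => by
            obtain ⟨h1, h2, h3⟩ := h.2.2 b hb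
            refine ⟨h1.imp id fun h => ⟨by simp [h.1], h.2⟩, h2, fun c hc hci => ?_⟩
            rcases List.mem_cons.1 hc with rfl | hc
            · rcases hcase with h | h
              · exact absurd hci h
              · exact (h2 _ rfl).trans h
            · exact h3 c hc hci⟩) le_rfl le_rfl
      refine QueryTree.Meets.mono (d := 2 * t.length + 1 + 1) (q := 0) (.indep hst' ?_)
        (fun _ _ h => h) (by rw [List.length_cons]; omega) le_rfl
      by_cases ha : O.isIndep i ((insert x S).erase a.1)
      · rw [if_pos ha]
        refine .test_form (fun h => ?_) fun h => ?_
        all_goals rw [map_sub, linearCombination_slotForm, linearCombination_slotForm] at h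
        · refine (ih (some a)).mono (fun o reg' h' => ⟨h'.1, fun ho => ?_, fun b hb => ?_⟩) le_rfl
            le_rfl
          · exact absurd (h'.2.1 ho).1 (by simp)
          · obtain ⟨h1, h2, h3⟩ := h'.2.2 b hb
            refine ⟨.inr ?_, ?_, ?_⟩
            · rcases h1 with h1 | h1
              · rw [Option.some_inj] at h1
                subst h1
                exact ⟨by simp, ha⟩
              · exact ⟨by simp [h1.1], h1.2⟩
            · intro c hc
              rw [Option.some_inj] at hc
              subst hc
              linarith [h2 _ rfl]
            · intro c hc hci
              rcases List.mem_cons.1 hc with rfl | hc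
              · exact h2 _ rfl
              · exact h3 c hc hci
        · exact keep (.inr (by linarith))
      · rw [if_neg ha]
        exact (keep (.inl ha)).mono (fun _ _ h => h) (by omega) le_rfl

/-- The search for a conflict of `x` with the current solution in the `i`-th matroid. -/
noncomputable def matroidPick (i : Fin p) (L : List (X × ℕ)) (x : X) :
    QueryTree X p (Option (Option (X × ℕ))) :=
  .indep i (insert x (selected L)) (.pure (some none))
    ((exchangeScan i (selected L) x L none).bind fun
      | none => .pure none
      | some b => .pure (some (some b)))

/-- If `x` does not extend the solution, the elements exchangeable for it form, together with `x`,
the fundamental circuit. A lightest one `b` is removed, and `x` is spanned by the rest of the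
circuit, whose weights are at least that of `b`. -/
theorem findsConflicts_matroidPick {Mat : Fin p → Matroid X} {f : Finset X → ℝ} {E : Finset X}
    (hE : ∀ i, (Mat i).E = E) (r : ℕ) :
    FindsConflicts (matroidSystem Mat) ⟨f, fun i S => (Mat i).Indep S⟩ E matroidPick r
      (2 * r + 1) := by
  intro L x store R reg w i hLE hx hind hr hreg hst _
  have hS : (Mat i).Indep (selected L : Set X) := hind i
  have hxS : x ∉ (selected L : Set X) := hx
  have hxE : x ∈ (Mat i).E := by
    rw [hE i]
    exact hLE (Finset.mem_insert_self _ _)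
  refine QueryTree.Meets.mono (d := 2 * L.length + 1) (q := 0) (.indep hst ?_)
    (fun _ _ h => h) (by omega) le_rfl
  split_ifs with hi
  · exact .pure ⟨rfl, hi⟩
  · replace hi : ¬ (Mat i).Indep (insert x (selected L : Set X)) := by
      rwa [← Finset.coe_insert]
    have hcl : x ∈ (Mat i).closure (selected L : Set X) := by
      by_contra h
      exact hi ((hS.insert_indep_iff_of_notMem hxS).2 ⟨hxE, h⟩)
    have hcirc := hS.fundCircuit_isCircuit hcl hxS
    have hmem : ∀ y, y ∈ (Mat i).fundCircuit x (selected L : Set X) ↔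
        (Mat i).Indep (((insert x (selected L)).erase y : Finset X) : Set X) := fun y => by
      rw [hS.mem_fundCircuit_iff hcl hxS, Finset.coe_erase, Finset.coe_insert]
    have hsub := (Mat i).fundCircuit_subset_insert x (selected L : Set X)
    refine (meets_exchangeScan (R := R) (reg := reg) hst L none).bind (d' := 0) (q' := 0)
      fun o reg' h => ?_
    obtain ⟨rfl, h1, h2⟩ := h
    cases o with
    | none =>
      -- If nothing can be exchanged, the circuit is contained in `{x}`, so `x` is a loop.
      refine .pure ⟨rfl, fun hxi => hcirc.not_indep (hxi.subset ?_)⟩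
      intro y hy
      rcases hsub hy with rfl | hyS
      · simp
      · obtain ⟨a, ha, rfl⟩ := mem_selected.1 (Finset.mem_coe.1 hyS)
        exact absurd ((hmem _).1 hy) ((h1 rfl).2 a ha)
    | some b =>
      obtain ⟨g1, -, g3⟩ := h2 b rfl
      obtain ⟨hbL, hbi⟩ := g1.resolve_left (by simp)
      have hbS : b.1 ∈ selected L := mem_selected.2 ⟨b, hbL, rfl⟩
      refine .pure ⟨rfl, hbL, .inr ?_, ?_⟩
      · refine (Mat i).closure_subset_closure ?_
          (hcirc.mem_closure_sdiff_singleton_of_mem ((Mat i).mem_fundCircuit x _))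
        rintro y ⟨hy, hyx⟩
        have hyS := Finset.mem_coe.1 ((hsub hy).resolve_left hyx)
        obtain ⟨a, ha, rfl⟩ := mem_selected.1 hyS
        rw [Finset.coe_filter]
        refine ⟨hyS, ?_⟩
        rw [← hreg a ha, ← hreg b hbL]
        exact g3 a ha ((hmem _).1 hy)
      · change (Mat i).Indep ((insert x (selected L \ {b.1}) : Finset X) : Set X)
        have hne : x ≠ b.1 := fun h => hx (by rwa [h])
        rwa [Finset.sdiff_singleton_eq_erase, ← Finset.erase_insert_of_ne hne]

/-- The machine depends on `p` and `N` only; the size `n` enters just the estimates, as the bound on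
the length of both solutions. -/
theorem exists_matroidIntersection_alg {p : ℕ} (hp : 1 ≤ p) (N : ℕ) :
    ∃ A : StreamAlg (Fin N) p,
      ∀ σ : List (Fin N), σ.Nodup →
      ∀ Mat : Fin p → Matroid (Fin N), (∀ i, (Mat i).E = {e | e ∈ σ}) →
      ∀ n : ℕ, IsGreatest {k | ∃ I : Finset (Fin N), (∀ i, (Mat i).Indep I) ∧ I.card = k} n →
      ∀ f : Finset (Fin N) → ℝ, IsMonoSubmodular σ.toFinset f →
        A.RunsWithin ⟨f, fun i S => (Mat i).Indep S⟩ σ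
          (200 * p * (n + 1)) (200 * p * (n + 1) * (Nat.log 2 N + 1))
          (200 * p * (σ.length + 1)) ∧
        ∃ I, A.Outputs ⟨f, fun i S => (Mat i).Indep S⟩ σ I ∧
          IsApproxMax σ.toFinset (fun S => ∀ i, (Mat i).Indep S) f
            (curvatureRatio (4 * p) (2 * (p + √((p : ℝ) * (p - 1))) - 1)
              (curvature σ.toFinset f)) I := by
  have henc : Function.Injective fun x : Fin N => Nat.bits x := fun _ _ h =>
    Fin.ext (bits_injective h)
  refine ⟨(exchangeProgram matroidPick (fun _ => Finset.univ) (√((p : ℝ) * (p - 1)) / p) 1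
    (fun x : Fin N => Nat.bits x) henc).toAlg _ henc, fun σ hσ Mat hMat n hn f hf => ?_⟩
  obtain ⟨h1, I, h2, h3⟩ := exchangeProgram_correct (M := matroidSystem Mat)
    (O := ⟨f, fun i S => (Mat i).Indep S⟩) hσ
    (findsConflicts_matroidPick (fun i => by rw [hMat i]; simp) n) hf rfl
    hp henc (fun x _ => length_bits_le x.2.le)
    (fun x _ => ⟨by simp [matroidSystem], ⟨⟨0, hp⟩, Finset.mem_univ _⟩⟩)
    (fun T _ hT => hn.2 ⟨T, hT, rfl⟩)
  refine ⟨h1.mono ?_ ?_ ?_, I, h2, h3⟩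
  · have : n + 1 ≤ p * (n + 1) := Nat.le_mul_of_pos_left _ hp
    rw [mul_assoc]
    omega
  · have hnN : n ≤ N := by
      obtain ⟨I, -, hI⟩ := hn.1
      rw [← hI]
      simpa using Finset.card_le_univ I
    have hlog : Nat.log 2 (2 * n) ≤ Nat.log 2 N + 1 := by
      rcases Nat.eq_zero_or_pos n with rfl | hn0
      · simp
      · rw [mul_comm, Nat.log_mul_base (by norm_num) hn0.ne']
        exact Nat.succ_le_succ (Nat.log_mono_right hnN)
    set B := Nat.log 2 N + 1
    have hB : 1 ≤ B := by omega
    have e1 : n * (2 * (2 * B + 1 + (Nat.log 2 (2 * n) + 1)) + 1) ≤ n * (20 * (p * B)) := by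
      have : B ≤ p * B := Nat.le_mul_of_pos_left _ hp
      exact Nat.mul_le_mul_left _ (by omega)
    have e2 : n * (20 * (p * B)) ≤ 20 * (p * (n + 1) * B) := by
      have : n * (20 * (p * B)) = 20 * (p * n * B) := by ring
      rw [this]
      gcongr
      omega
    have e3 : B ≤ p * (n + 1) * B := Nat.le_mul_of_pos_left _ (by positivity)
    have e4 : p * (2 * n + 1) ≤ 2 * (p * (n + 1) * B) := by
      calc p * (2 * n + 1) ≤ p * (2 * (n + 1)) := Nat.mul_le_mul_left _ (by omega)
        _ = 2 * (p * (n + 1)) := by ring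
        _ ≤ 2 * (p * (n + 1) * B) := Nat.mul_le_mul_left _ (Nat.le_mul_of_pos_right _ hB)
    have e5 : 200 * p * (n + 1) * B = 200 * (p * (n + 1) * B) := by ring
    rw [e5]
    omega
  · exact Nat.mul_le_mul_right _ (by omega)

end MatroidIntersection

theorem theorem4 :
    -- submodular matching in graph streams
    (∃ K : ℕ, ∀ n : ℕ, ∃ A : StreamAlg (Sym2 (Fin n)) 0,
      ∀ σ : List (Sym2 (Fin n)), σ.Nodup → (∀ e ∈ σ, ¬ e.IsDiag) →
      ∀ f : Finset (Sym2 (Fin n)) → ℝ, IsMonoSubmodular σ.toFinset f →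
        A.RunsWithin ⟨f, fun i => i.elim0⟩ σ
          (K * n) (K * n * (Nat.log 2 n + 1)) (K * (σ.length + 1)) ∧
        ∃ M, A.Outputs ⟨f, fun i => i.elim0⟩ σ M ∧
          IsApproxMax σ.toFinset IsGraphMatching f
            (curvatureRatio 7.75 5.585 (curvature σ.toFinset f)) M) ∧
    -- submodular matching in `p`-hypergraph streams
    (∀ p : ℕ, 1 ≤ p → ∃ K : ℕ, ∀ n : ℕ, ∃ A : StreamAlg (Finset (Fin n)) 0,
      ∀ σ : List (Finset (Fin n)), σ.Nodup → (∀ e ∈ σ, e.card ≤ p) →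
      ∀ f : Finset (Finset (Fin n)) → ℝ, IsMonoSubmodular σ.toFinset f →
        A.RunsWithin ⟨f, fun i => i.elim0⟩ σ
          (K * (n + 1)) (K * (n + 1) * (Nat.log 2 (n + 1) + 1)) (K * (σ.length + 1)) ∧
        ∃ M, A.Outputs ⟨f, fun i => i.elim0⟩ σ M ∧
          IsApproxMax σ.toFinset IsHyperMatching f
            (curvatureRatio (4 * p) (2 * (p + √((p : ℝ) * (p - 1))) - 1)
              (curvature σ.toFinset f)) M) ∧
    -- submodular maximization over the intersection of `p` matroids; the elements of the
    -- common ground set carry names from a set of `N` names, and `n` is the maximum size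
    -- of a common independent set
    (∀ p : ℕ, 1 ≤ p → ∃ K : ℕ, ∀ N : ℕ, ∃ A : StreamAlg (Fin N) p,
      ∀ σ : List (Fin N), σ.Nodup →
      ∀ Mat : Fin p → Matroid (Fin N), (∀ i, (Mat i).E = {e | e ∈ σ}) →
      ∀ n : ℕ, IsGreatest {k | ∃ I : Finset (Fin N), (∀ i, (Mat i).Indep I) ∧ I.card = k} n →
      ∀ f : Finset (Fin N) → ℝ, IsMonoSubmodular σ.toFinset f →
        A.RunsWithin ⟨f, fun i S => (Mat i).Indep S⟩ σ
          (K * (n + 1)) (K * (n + 1) * (Nat.log 2 N + 1)) (K * (σ.length + 1)) ∧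
        ∃ I, A.Outputs ⟨f, fun i S => (Mat i).Indep S⟩ σ I ∧
          IsApproxMax σ.toFinset (fun S => ∀ i, (Mat i).Indep S) f
            (curvatureRatio (4 * p) (2 * (p + √((p : ℝ) * (p - 1))) - 1)
              (curvature σ.toFinset f)) I) := by
  exact ⟨⟨400, exists_matching_alg⟩, fun p hp => ⟨200 * p, exists_hypermatching_alg hp⟩,
    fun p hp => ⟨200 * p, exists_matroidIntersection_alg hp⟩⟩
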